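/- Let $N\ge 1$, let $|\cdot|$ denote the Euclidean norm of vectors and the Frobenius norm of matrices, and let $\rho_n:\mathbb{R}^N\to[0,\infty)$, $n\in\mathbb{N}$, be radial integrable functions with $$\int_{\mathbb{R}^N}\rho_n(x)\,dx=1\quad\text{for all } n,\qquad \lim_{n\to\infty}\int_{|x|>\gamma}\rho_n(x)\,dx=0\quad\text{for all }\gamma>0 .$$ For $\varphi\in C_c^\infty(\mathbb{R}^N)$ and $1\le i,j\le N$ put $$H_n^{ij}\varphi(x)=\frac{N(N+2)}{2}\int_{\mathbb{R}^N}\frac{\varphi(x+h)-2\varphi(x)+\varphi(x-h)}{|h|^2}\;\frac{h_ih_j-\delta_{ij}\frac{|h|^2}{N+2}}{|h|^2}\,\rho_n(h)\,dh ,$$ and for $u\in L^1(\mathbb{R}^N)$ let $\mathfrak{H}_nu$ be the matrix-valued distribution with entries $\langle\mathfrak{H}_n^{ij}u,\varphi\rangle=\int_{\mathbb{R}^N}u\,H_n^{ij}\varphi\,dx$. Let $$F_n(u)=\int_{\mathbb{R}^N}|\mathfrak{H}_nu|\,dx\in[0,+\infty]$$ if the distribution $\mathfrak{H}_nu$ is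 given by a locally integrable function, and $F_n(u)=+\infty$ otherwise. Let $\mathrm{BV}^2(\mathbb{R}^N)$ be the space of all $u\in W^{1,1}(\mathbb{R}^N)$ such that the distributional derivative $D^2u:=D(\nabla u)$ of the weak gradient of $u$ is a finite $\mathbb{R}^{N\times N}$-valued Radon measure. Let $F(u)=|D^2u|(\mathbb{R}^N)$ be the total variation of this measure if $u\in\mathrm{BV}^2(\mathbb{R}^N)$, and $F(u)=+\infty$ if $u\in L^1(\mathbb{R}^N)\setminus\mathrm{BV}^2(\mathbb{R}^N)$. Then $F_n$ $\Gamma$-converges to $F$ with respect to strong convergence in $L^1(\mathbb{R}^N)$; that is, for every $u\in L^1(\mathbb{R}^N)$: 1. for every sequence $u_n\to u$ in $L^1(\mathbb{R}^N)$ we have $F(u)\le\liminf_{n\to\infty}F_n(u_n)$; 2. there is a sequence $u_n\to u$ in $L^1(\mathbb{R}^N)$ with $\limsup_{n\to\infty}F_n(u_n)\le F(u)$. -/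

import Mathlib

open MeasureTheory Filter Topology
open scoped ContDiff

noncomputable section

namespace NonlocalHessian

/-- `ℝ^N` with its Euclidean norm. -/
abbrev RN (N : ℕ) : Type := EuclideanSpace ℝ (Fin N)

/-- Real `N × N` matrices with the Frobenius norm, i.e. the Euclidean norm of the family of
entries; the entry `(i, j)` of `A` is `A (i, j)`. -/
abbrev Mat (N : ℕ) : Type := EuclideanSpace ℝ (Fin N × Fin N)

/-- `φ ∈ C_c^∞(ℝ^N)`. -/
structure IsTestFunction {N : ℕ} (φ : RN N → ℝ) : Prop where
  contDiff : ContDiff ℝ ∞ φ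
  hasCompactSupport : HasCompactSupport φ

/-- The classical partial derivative `∂φ/∂x_i`. -/
def partialDeriv {N : ℕ} (i : Fin N) (φ : RN N → ℝ) (x : RN N) : ℝ :=
  fderiv ℝ φ x (EuclideanSpace.single i 1)

/-! ### The mollifiers -/

/-- A sequence of radial mollifiers: nonnegative radial functions of integral one whose mass
concentrates at the origin. -/
structure IsRadialMollifierSeq {N : ℕ} (ρ : ℕ → RN N → ℝ) : Prop where
  radial : ∀ n x y, ‖x‖ = ‖y‖ → ρ n x = ρ n y
  nonneg : ∀ n x, 0 ≤ ρ n x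
  integrable : ∀ n, Integrable (ρ n)
  integral_eq_one : ∀ n, ∫ x, ρ n x = 1
  tail : ∀ γ : ℝ, 0 < γ → Tendsto (fun n => ∫ x in {x : RN N | γ < ‖x‖}, ρ n x) atTop (𝓝 0)

/-! ### The non-local Hessian -/

/-- The entry `(i, j)` of the non-local Hessian of `φ` with weight `ρ`, at the point `x`:
`N(N+2)/2 ∫ (φ(x+h) - 2φ(x) + φ(x-h))/|h|² (h_i h_j - δ_{ij} |h|²/(N+2))/|h|² ρ(h) dh`. -/
def nonlocalHess {N : ℕ} (ρ : RN N → ℝ) (i j : Fin N) (φ : RN N → ℝ) (x : RN N) : ℝ :=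
  (N : ℝ) * ((N : ℝ) + 2) / 2 *
    ∫ h : RN N, (φ (x + h) - 2 * φ x + φ (x - h)) / ‖h‖ ^ 2 *
      ((h i * h j - (if i = j then ‖h‖ ^ 2 / ((N : ℝ) + 2) else 0)) / ‖h‖ ^ 2) * ρ h

/-- The entry `(i, j)` of the distributional non-local Hessian of `u`, applied to the test
function `φ`. -/
def distNonlocalHess {N : ℕ} (ρ : RN N → ℝ) (i j : Fin N) (u : RN N → ℝ) (φ : RN N → ℝ) : ℝ :=
  ∫ x, u x * nonlocalHess ρ i j φ x

/-- The distributional non-local Hessian of `u` is (the regular distribution given by) the locally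
integrable matrix field `G`. -/
structure IsNonlocalHessianFunction {N : ℕ} (ρ : RN N → ℝ) (u : RN N → ℝ)
    (G : RN N → Mat N) : Prop where
  locallyIntegrable : LocallyIntegrable G
  pairing : ∀ φ : RN N → ℝ, IsTestFunction φ → ∀ i j : Fin N,
    distNonlocalHess ρ i j u φ = ∫ x, G x (i, j) * φ x

/-- The non-local energy: the `L¹` norm of the distributional non-local Hessian of `u` if this
distribution is a function, and `+∞` otherwise. (The function is unique up to null sets, so the
infimum is over at most one value; it is `⊤` if there is none.) -/
def nonlocalEnergy {N : ℕ} (ρ : RN N → ℝ) (u : RN N → ℝ) : ENNReal :=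
  ⨅ (G : RN N → Mat N) (_ : IsNonlocalHessianFunction ρ u G), ∫⁻ x, ‖G x‖ₑ

/-! ### Functions of bounded Hessian -/

/-- `g` is the weak gradient of `u`. -/
def IsWeakGradient {N : ℕ} (u : RN N → ℝ) (g : RN N → RN N) : Prop :=
  ∀ φ : RN N → ℝ, IsTestFunction φ → ∀ i : Fin N,
    ∫ x, u x * partialDeriv i φ x = - ∫ x, g x i * φ x

/-- The distributional derivative `(∂_j g_i)_{ij}` of the vector field `g` is the finite
matrix-valued Borel measure `μ`. -/
structure IsDerivMeasure {N : ℕ} (g : RN N → RN N) (μ : VectorMeasure (RN N) (Mat N)) : Prop where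
  finite : μ.variation Set.univ < ⊤
  pairing : ∀ φ : RN N → ℝ, IsTestFunction φ → ∀ i j : Fin N,
    ∫ x, g x i * partialDeriv j φ x = - (∫ᵛ x, φ x ∂•μ) (i, j)

/-- `u ∈ BV²(ℝ^N)` with `D²u = μ`: the function `u` belongs to `W^{1,1}(ℝ^N)`, and the
distributional derivative of its weak gradient is the finite matrix-valued measure `μ`. -/
def IsHessianMeasure {N : ℕ} (u : RN N → ℝ) (μ : VectorMeasure (RN N) (Mat N)) : Prop :=
  Integrable u ∧ ∃ g : RN N → RN N, Integrable g ∧ IsWeakGradient u g ∧ IsDerivMeasure g μ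

/-- The space `BV²(ℝ^N)` of functions of bounded Hessian. -/
def MemBV2 {N : ℕ} (u : RN N → ℝ) : Prop :=
  ∃ μ : VectorMeasure (RN N) (Mat N), IsHessianMeasure u μ

/-- `|D²u|(ℝ^N)`: the total variation of the matrix-valued measure `D²u` if `u ∈ BV²(ℝ^N)`, and
`+∞` otherwise. (The measure `D²u` is unique, so the infimum is over at most one value.) -/
def hessianVariation {N : ℕ} (u : RN N → ℝ) : ENNReal :=
  ⨅ (μ : VectorMeasure (RN N) (Mat N)) (_ : IsHessianMeasure u μ), μ.variation Set.univ

theorem hessianVariation_eq_top {N : ℕ} {u : RN N → ℝ} (hu : ¬ MemBV2 u) :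
    hessianVariation u = ⊤ := by
  simp only [hessianVariation, iInf_eq_top]
  intro μ hμ
  exact absurd ⟨μ, hμ⟩ hu

theorem hessianVariation_lt_top {N : ℕ} {u : RN N → ℝ} (hu : MemBV2 u) :
    hessianVariation u < ⊤ := by
  obtain ⟨μ, hμ⟩ := hu
  obtain ⟨-, g, -, -, hg⟩ := id hμ
  exact lt_of_le_of_lt (iInf₂_le μ hμ) hg.finite

/-! ### Γ-convergence -/

/-- The functionals `F n` on the metric space `X` Γ-converge at the point `x` to the
functional `Flim`. -/
structure GammaConvergesAt {X : Type*} [MetricSpace X] (F : ℕ → X → ENNReal)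
    (Flim : X → ENNReal) (x : X) : Prop where
  liminf_le : ∀ y : ℕ → X, Tendsto y atTop (𝓝 x) →
    Flim x ≤ liminf (fun n => F n (y n)) atTop
  exists_limsup_le : ∃ y : ℕ → X, Tendsto y atTop (𝓝 x) ∧
    limsup (fun n => F n (y n)) atTop ≤ Flim x

end NonlocalHessian

end

noncomputable section

namespace NonlocalHessian

variable {N : ℕ}

/-! ### Moments of radial weights -/

/-! A radial probability density has the fourth moments of the uniform measure on the sphere: the
mean of `h_k h_l h_i h_j / |h|^4` is `(δ_kl δ_ij + δ_ki δ_lj + δ_kj δ_li) / (N(N+2))`. The trace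
correction in the weight cancels the first term, so on quadratic functions the non-local Hessian is
exactly the Hessian (`integral_bilin_hessWeight`). For a test function `φ` the error is therefore an
integral of a Taylor remainder of size `|h|² min(1,|h|)`. It is at most a constant depending on `φ`
times `truncMoment ρ = ∫ min(1,|h|) ρ`, both uniformly in `x` and in `L¹`, and `truncMoment (ρ n)`
tends to zero.

Lower bound: densities of energy below `L` have a weak limit `μ` of variation at most `L`
(`exists_weak_limit_mat`). Uniform convergence of the non-local Hessians of `φ`, together with `L¹`
convergence of the functions, identifies `μ` with the distributional Hessian of `u`. The definition
of `BV²` also asks for an integrable weak gradient. This comes from the interpolation `‖∂v‖₁ ≤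
(2/t)‖v‖₁ + t‖∂²v‖₁`, which makes the gradients of the mollifications Cauchy in `L¹`
(`IsDistHessian.isHessianMeasure`).

Upper bound: mollify. The non-local Hessian of `u * η` is `u * Hη`, which is `L¹`-close to `u * D²η
= D²(u * η)`, and the latter has `L¹` norm at most `|D²u|(ℝ^N)` when `‖η‖₁ = 1`. The error constant
depends on `η`, so the mollification parameter is sent to its limit slowly by a diagonal choice
(`exists_diagonal`). -/

/-- A single radial mollifier. -/
structure IsRadialMollifier (ρ : RN N → ℝ) : Prop where
  radial : ∀ x y, ‖x‖ = ‖y‖ → ρ x = ρ y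
  nonneg : ∀ x, 0 ≤ ρ x
  integrable : Integrable ρ
  integral_eq_one : ∫ x, ρ x = 1

theorem IsRadialMollifierSeq.isRadialMollifier {ρ : ℕ → RN N → ℝ} (h : IsRadialMollifierSeq ρ)
    (n : ℕ) : IsRadialMollifier (ρ n) :=
  ⟨h.radial n, h.nonneg n, h.integrable n, h.integral_eq_one n⟩

/-- The mixed fourth moment of the spherical part of `ρ`. -/
def quartic (ρ : RN N → ℝ) (w x y z : RN N) : ℝ :=
  ∫ h : RN N, inner ℝ h w * inner ℝ h x * inner ℝ h y * inner ℝ h z / ‖h‖ ^ 4 * ρ h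

theorem abs_quartic_integrand_le (w x y z h : RN N) :
    |inner ℝ h w * inner ℝ h x * inner ℝ h y * inner ℝ h z / ‖h‖ ^ 4| ≤
      ‖w‖ * ‖x‖ * ‖y‖ * ‖z‖ := by
  rcases eq_or_ne h 0 with rfl | hh
  · simp; positivity
  have hp : 0 < ‖h‖ := norm_pos_iff.2 hh
  rw [abs_div, abs_of_pos (pow_pos hp 4), div_le_iff₀ (by positivity), abs_mul, abs_mul, abs_mul]
  calc _ ≤ (‖h‖ * ‖w‖) * (‖h‖ * ‖x‖) * (‖h‖ * ‖y‖) * (‖h‖ * ‖z‖) := by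
        gcongr <;> exact abs_real_inner_le_norm _ _
    _ = _ := by ring

theorem integrable_mul_of_bound {f ρ : RN N → ℝ} (hρ : Integrable ρ) (hf : Measurable f)
    {C : ℝ} (hC : ∀ h, |f h| ≤ C) : Integrable (fun h => f h * ρ h) :=
  hρ.bdd_mul hf.aestronglyMeasurable (Eventually.of_forall hC)

theorem integrable_quartic {ρ : RN N → ℝ} (hρ : Integrable ρ) (w x y z : RN N) :
    Integrable (fun h : RN N =>
      inner ℝ h w * inner ℝ h x * inner ℝ h y * inner ℝ h z / ‖h‖ ^ 4 * ρ h) :=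
  integrable_mul_of_bound hρ (by fun_prop) (abs_quartic_integrand_le w x y z)

/-- The reflection in the hyperplane orthogonal to `ξ - ζ` carries `ξ` to `ζ` and preserves both
Lebesgue measure and `ρ`. -/
theorem quartic_diag_eq {ρ : RN N → ℝ} (hρ : ∀ x y, ‖x‖ = ‖y‖ → ρ x = ρ y) {ξ ζ : RN N}
    (h : ‖ξ‖ = ‖ζ‖) : quartic ρ ξ ξ ξ ξ = quartic ρ ζ ζ ζ ζ := by
  set R := (ℝ ∙ (ξ - ζ))ᗮ.reflection
  have hR : R ξ = ζ := Submodule.reflection_sub h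
  unfold quartic
  symm
  rw [← (LinearIsometryEquiv.measurePreserving R).integral_comp
    R.toHomeomorph.measurableEmbedding]
  refine integral_congr_ae (Eventually.of_forall fun x => ?_)
  have e : inner ℝ (R x) ζ = inner ℝ x ξ := by rw [← hR, R.inner_map_map]
  simp only
  rw [hρ (R x) x (by simp), e, R.norm_map]

theorem quartic_diag_smul (ρ : RN N → ℝ) (t : ℝ) (ξ : RN N) :
    quartic ρ (t • ξ) (t • ξ) (t • ξ) (t • ξ) = t ^ 4 * quartic ρ ξ ξ ξ ξ := by
  unfold quartic
  rw [← integral_const_mul]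
  refine integral_congr_ae (Eventually.of_forall fun x => ?_)
  simp only [inner_smul_right]
  ring

/-- All unit vectors give the same value, and the form is homogeneous of degree four. The index `i`
only supplies a unit vector. -/
theorem exists_quartic_diag {ρ : RN N → ℝ} (hρ : ∀ x y, ‖x‖ = ‖y‖ → ρ x = ρ y) (i : Fin N) :
    ∃ c : ℝ, ∀ ξ : RN N, quartic ρ ξ ξ ξ ξ = c * ‖ξ‖ ^ 4 := by
  refine ⟨quartic ρ (EuclideanSpace.single i 1) (EuclideanSpace.single i 1)
    (EuclideanSpace.single i 1) (EuclideanSpace.single i 1), fun ξ => ?_⟩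
  rw [quartic_diag_eq hρ (ζ := ‖ξ‖ • EuclideanSpace.single i 1) (by simp [norm_smul]),
    quartic_diag_smul]
  ring

/-- Polarization of a symmetric four-linear form: eight sign choices, each contributing the `4!`
orderings of the mixed term, whence `192 = 8 · 24`. -/
theorem quartic_polarization {ρ : RN N → ℝ} (hρ : Integrable ρ) (w x y z : RN N) :
    192 * quartic ρ w x y z =
      (quartic ρ (w + x + y + z) (w + x + y + z) (w + x + y + z) (w + x + y + z)
      - quartic ρ (w + x + y - z) (w + x + y - z) (w + x + y - z) (w + x + y - z)
      - quartic ρ (w + x - y + z) (w + x - y + z) (w + x - y + z) (w + x - y + z)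
      + quartic ρ (w + x - y - z) (w + x - y - z) (w + x - y - z) (w + x - y - z)
      - quartic ρ (w - x + y + z) (w - x + y + z) (w - x + y + z) (w - x + y + z)
      + quartic ρ (w - x + y - z) (w - x + y - z) (w - x + y - z) (w - x + y - z)
      + quartic ρ (w - x - y + z) (w - x - y + z) (w - x - y + z) (w - x - y + z)
      - quartic ρ (w - x - y - z) (w - x - y - z) (w - x - y - z) (w - x - y - z)) := by
  have I := integrable_quartic hρ
  unfold quartic
  rw [← integral_const_mul, ← integral_sub (I _ _ _ _) (I _ _ _ _), ← integral_sub _ (I _ _ _ _),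
    ← integral_add _ (I _ _ _ _), ← integral_sub _ (I _ _ _ _), ← integral_add _ (I _ _ _ _),
    ← integral_add _ (I _ _ _ _), ← integral_sub _ (I _ _ _ _)]
  · refine integral_congr_ae (Eventually.of_forall fun h => ?_)
    simp only [inner_add_right, inner_sub_right]
    ring
  all_goals
    repeat' first | exact I _ _ _ _ | refine Integrable.sub ?_ ?_ | refine Integrable.add ?_ ?_

theorem exists_quartic_eq {ρ : RN N → ℝ} (hρ : IsRadialMollifier ρ) (i : Fin N) :
    ∃ c : ℝ, ∀ w x y z : RN N, quartic ρ w x y z =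
      c * (inner ℝ w x * inner ℝ y z + inner ℝ w y * inner ℝ x z + inner ℝ w z * inner ℝ x y) := by
  obtain ⟨c, hc⟩ := exists_quartic_diag hρ.radial i
  -- On the diagonal the three pairings coincide, so each carries a third of the diagonal constant.
  refine ⟨c / 3, fun w x y z => ?_⟩
  have h := quartic_polarization hρ.integrable w x y z
  have hn : ∀ ξ : RN N, ‖ξ‖ ^ 4 = inner ℝ ξ ξ * inner ℝ ξ ξ := fun ξ => by
    rw [real_inner_self_eq_norm_sq]; ring
  simp only [hc, hn, inner_add_right, inner_sub_right, inner_add_left, inner_sub_left] at h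
  rw [real_inner_comm w x, real_inner_comm w y, real_inner_comm w z, real_inner_comm x y,
    real_inner_comm x z, real_inner_comm y z] at h
  linarith

theorem sum_inner_single_sq (h : RN N) :
    ∑ k, inner ℝ h (EuclideanSpace.single k (1 : ℝ)) * inner ℝ h (EuclideanSpace.single k 1)
      = ‖h‖ ^ 2 := by
  rw [EuclideanSpace.norm_sq_eq]
  simp [EuclideanSpace.inner_single_right, sq]

theorem sum_quartic {ρ : RN N → ℝ} (hρ : Integrable ρ) (w x : RN N) :
    ∑ k, quartic ρ w x (EuclideanSpace.single k 1) (EuclideanSpace.single k 1) =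
      ∫ h : RN N, inner ℝ h w * inner ℝ h x / ‖h‖ ^ 2 * ρ h := by
  unfold quartic
  rw [← integral_finsetSum _ fun k _ => integrable_quartic hρ _ _ _ _]
  refine integral_congr_ae (Eventually.of_forall fun h => ?_)
  simp only
  rcases eq_or_ne h 0 with rfl | hh
  · simp
  have hp : ‖h‖ ≠ 0 := norm_ne_zero_iff.2 hh
  rw [← Finset.sum_mul, ← Finset.sum_div]
  simp only [mul_assoc]
  rw [← Finset.mul_sum, ← Finset.mul_sum, sum_inner_single_sq]
  field_simp

theorem sum_inner_inner_single (w x : RN N) :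
    ∑ k, inner ℝ w (EuclideanSpace.single k (1 : ℝ)) * inner ℝ x (EuclideanSpace.single k 1)
      = inner ℝ w x := by
  simp [PiLp.inner_apply, mul_comm]

/-- The fourth moments of a radial probability density, normalised to the sphere. -/
theorem quartic_eq {ρ : RN N → ℝ} (hN : 1 ≤ N) (hρ : IsRadialMollifier ρ) (w x y z : RN N) :
    quartic ρ w x y z = ((N : ℝ) * (N + 2))⁻¹ *
      (inner ℝ w x * inner ℝ y z + inner ℝ w y * inner ℝ x z + inner ℝ w z * inner ℝ x y) := by
  obtain ⟨c, hc⟩ := exists_quartic_eq hρ ⟨0, hN⟩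
  -- Contracting the last two slots: the first pairing contributes a factor `N`, the two others a
  -- factor `1` each.
  have h2 : ∀ w x : RN N, ∫ h : RN N, inner ℝ h w * inner ℝ h x / ‖h‖ ^ 2 * ρ h =
      c * (N + 2) * inner ℝ w x := fun w x => by
    rw [← sum_quartic hρ.integrable, Finset.sum_congr rfl fun k _ => hc _ _ _ _,
      ← Finset.mul_sum, Finset.sum_add_distrib, Finset.sum_add_distrib, sum_inner_inner_single]
    simp
    ring
  -- Contracting the remaining two slots recovers the total mass, so `1 = c N (N + 2)`.
  have h3 : ∫ h : RN N, ρ h = ∑ k : Fin N, ∫ h : RN N,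
      inner ℝ h (EuclideanSpace.single k (1 : ℝ)) * inner ℝ h (EuclideanSpace.single k 1) /
        ‖h‖ ^ 2 * ρ h := by
    rw [← integral_finsetSum]
    -- Positive dimension makes the origin a null set; there the quotients by `‖h‖` are zero by
    -- convention.
    · have : Nonempty (Fin N) := ⟨⟨0, hN⟩⟩
      have : ∀ᵐ h : RN N, h ≠ 0 := by
        simp [ae_iff]
      refine integral_congr_ae ?_
      filter_upwards [this] with h hh
      have hp : ‖h‖ ≠ 0 := norm_ne_zero_iff.2 hh
      rw [← Finset.sum_mul, ← Finset.sum_div, sum_inner_single_sq]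
      field_simp
    · intro k _
      refine integrable_mul_of_bound hρ.integrable (by fun_prop) (C := 1) fun h => ?_
      rcases eq_or_ne h 0 with rfl | hh
      · simp
      have hp : 0 < ‖h‖ := norm_pos_iff.2 hh
      rw [abs_div, abs_of_pos (pow_pos hp 2), div_le_iff₀ (by positivity), abs_mul]
      have := abs_real_inner_le_norm h (EuclideanSpace.single k (1 : ℝ))
      simp only [PiLp.norm_single, norm_one, mul_one] at this
      nlinarith [abs_nonneg (inner ℝ h (EuclideanSpace.single k (1 : ℝ)))]
  rw [hρ.integral_eq_one, Finset.sum_congr rfl fun k _ => h2 _ _] at h3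
  simp at h3
  have hN0 : (N : ℝ) ≠ 0 := by positivity
  rw [hc]
  congr 1
  field_simp
  linarith

theorem integral_inner_mul_inner {ρ : RN N → ℝ} (hN : 1 ≤ N) (hρ : IsRadialMollifier ρ)
    (w x : RN N) :
    ∫ h : RN N, inner ℝ h w * inner ℝ h x / ‖h‖ ^ 2 * ρ h = (N : ℝ)⁻¹ * inner ℝ w x := by
  rw [← sum_quartic hρ.integrable, Finset.sum_congr rfl fun k _ => quartic_eq hN hρ _ _ _ _,
    ← Finset.mul_sum, Finset.sum_add_distrib, Finset.sum_add_distrib, sum_inner_inner_single]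
  have hN0 : (N : ℝ) ≠ 0 := by positivity
  simp
  field_simp
  ring

/-! ### Taylor expansion of test functions -/

/-- The second derivative of `φ`. -/
def hess (φ : RN N → ℝ) (x : RN N) : RN N →L[ℝ] RN N →L[ℝ] ℝ := fderiv ℝ (fderiv ℝ φ) x

/-- The second difference of `φ`. -/
def secondDiff (φ : RN N → ℝ) (x h : RN N) : ℝ := φ (x + h) - 2 * φ x + φ (x - h)

/-- The tensorial weight in the non-local Hessian. -/
def hessWeight (i j : Fin N) (h : RN N) : ℝ :=
  (h i * h j - (if i = j then ‖h‖ ^ 2 / ((N : ℝ) + 2) else 0)) / ‖h‖ ^ 2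

theorem nonlocalHess_eq (ρ : RN N → ℝ) (i j : Fin N) (φ : RN N → ℝ) (x : RN N) :
    nonlocalHess ρ i j φ x = (N : ℝ) * ((N : ℝ) + 2) / 2 *
      ∫ h : RN N, secondDiff φ x h / ‖h‖ ^ 2 * hessWeight i j h * ρ h := rfl

theorem abs_hessWeight_le (i j : Fin N) (h : RN N) : |hessWeight i j h| ≤ 2 := by
  rcases eq_or_ne h 0 with rfl | hh
  · simp [hessWeight]
  have hp : 0 < ‖h‖ := norm_pos_iff.2 hh
  have hc : ∀ k, |h k| ≤ ‖h‖ := fun k => by simpa using PiLp.norm_apply_le h k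
  have h1 : |h i * h j| ≤ ‖h‖ ^ 2 := by
    rw [abs_mul, sq]; exact mul_le_mul (hc i) (hc j) (abs_nonneg _) hp.le
  have h2 : |if i = j then ‖h‖ ^ 2 / ((N : ℝ) + 2) else 0| ≤ ‖h‖ ^ 2 := by
    split_ifs
    · rw [abs_of_nonneg (by positivity)]
      exact div_le_self (by positivity) (by linarith [(Nat.cast_nonneg N : (0 : ℝ) ≤ N)])
    · simp
  rw [hessWeight, abs_div, abs_of_pos (pow_pos hp 2), div_le_iff₀ (by positivity)]
  linarith [abs_sub (h i * h j) (if i = j then ‖h‖ ^ 2 / ((N : ℝ) + 2) else 0)]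

theorem measurable_hessWeight (i j : Fin N) : Measurable (hessWeight i j : RN N → ℝ) := by
  unfold hessWeight
  split_ifs <;> fun_prop

theorem IsTestFunction.continuous {φ : RN N → ℝ} (hφ : IsTestFunction φ) : Continuous φ :=
  hφ.contDiff.continuous

theorem IsTestFunction.integrable {φ : RN N → ℝ} (hφ : IsTestFunction φ) : Integrable φ :=
  hφ.continuous.integrable_of_hasCompactSupport hφ.hasCompactSupport

theorem IsTestFunction.partialDeriv {φ : RN N → ℝ} (hφ : IsTestFunction φ) (i : Fin N) :
    IsTestFunction (partialDeriv i φ) where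
  contDiff := (hφ.contDiff.fderiv_right (m := ∞) (by simp)).clm_apply contDiff_const
  hasCompactSupport := hφ.hasCompactSupport.fderiv_apply ℝ _

theorem IsTestFunction.contDiff_fderiv {φ : RN N → ℝ} (hφ : IsTestFunction φ) :
    ContDiff ℝ ∞ (fderiv ℝ φ) := hφ.contDiff.fderiv_right (m := ∞) (by simp)

theorem IsTestFunction.contDiff_hess {φ : RN N → ℝ} (hφ : IsTestFunction φ) :
    ContDiff ℝ ∞ (hess φ) := hφ.contDiff_fderiv.fderiv_right (m := ∞) (by simp)

theorem IsTestFunction.hasCompactSupport_hess {φ : RN N → ℝ} (hφ : IsTestFunction φ) :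
    HasCompactSupport (hess φ) := (hφ.hasCompactSupport.fderiv ℝ).fderiv ℝ

theorem IsTestFunction.hasFDerivAt {φ : RN N → ℝ} (hφ : IsTestFunction φ) (x : RN N) :
    HasFDerivAt φ (fderiv ℝ φ x) x := (hφ.contDiff.differentiable (by simp) x).hasFDerivAt

theorem IsTestFunction.hasFDerivAt_fderiv {φ : RN N → ℝ} (hφ : IsTestFunction φ) (x : RN N) :
    HasFDerivAt (fderiv ℝ φ) (hess φ x) x :=
  (hφ.contDiff_fderiv.differentiable (by simp) x).hasFDerivAt

theorem IsTestFunction.partialDeriv_partialDeriv {φ : RN N → ℝ} (hφ : IsTestFunction φ)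
    (i j : Fin N) (x : RN N) :
    NonlocalHessian.partialDeriv i (NonlocalHessian.partialDeriv j φ) x =
      hess φ x (EuclideanSpace.single i 1) (EuclideanSpace.single j 1) := by
  have := ((hφ.hasFDerivAt_fderiv x).clm_apply
    (hasFDerivAt_const (EuclideanSpace.single j (1 : ℝ)) x)).fderiv
  change fderiv ℝ (fun y => fderiv ℝ φ y (EuclideanSpace.single j (1 : ℝ))) x _ = _
  rw [this]
  simp

theorem IsTestFunction.hess_symm {φ : RN N → ℝ} (hφ : IsTestFunction φ) (x v w : RN N) :
    hess φ x v w = hess φ x w v := by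
  have : IsSymmSndFDerivAt ℝ φ x := hφ.contDiff.contDiffAt.isSymmSndFDerivAt (by
    simpa using WithTop.coe_le_coe.2 (le_top : (2 : ℕ∞) ≤ ⊤))
  exact this.eq v w

/-- Mean value inequality for `s ↦ Dφ(x+sk) - Dφ(x-sk) - 2s D²φ(x)k`: its derivative is a sum of two
increments of `D²φ` applied to `k`, each at most `L‖k‖²`. -/
theorem norm_fderiv_add_sub_le {φ : RN N → ℝ} (hφ : IsTestFunction φ) {L : ℝ} (hL0 : 0 ≤ L)
    (hL : ∀ x y, ‖hess φ x - hess φ y‖ ≤ L * ‖x - y‖) (x k : RN N) :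
    ‖fderiv ℝ φ (x + k) - fderiv ℝ φ (x - k) - (2 : ℝ) • hess φ x k‖ ≤ 2 * L * ‖k‖ ^ 2 := by
  have hd : ∀ s : ℝ, HasDerivAt
      (fun s : ℝ => fderiv ℝ φ (x + s • k) - fderiv ℝ φ (x - s • k) - (2 * s) • hess φ x k)
      (hess φ (x + s • k) k + hess φ (x - s • k) k - (2 : ℝ) • hess φ x k) s := fun s => by
    have h1 : HasDerivAt (fun s : ℝ => x + s • k) k s := by
      simpa using ((hasDerivAt_id s).smul_const k).const_add x
    have h2 : HasDerivAt (fun s : ℝ => x - s • k) (-k) s := by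
      simpa using ((hasDerivAt_id s).smul_const k).const_sub x
    have h3 : HasDerivAt (fun s : ℝ => (2 * s) • hess φ x k) ((2 : ℝ) • hess φ x k) s := by
      simpa using ((hasDerivAt_id s).const_mul (2 : ℝ)).smul_const (hess φ x k)
    have h4 := (hφ.hasFDerivAt_fderiv (x + s • k)).comp_hasDerivAt s h1
    have h5 := (hφ.hasFDerivAt_fderiv (x - s • k)).comp_hasDerivAt s h2
    exact ((h4.sub h5).sub h3).congr_deriv (by simp)
  have := norm_image_sub_le_of_norm_deriv_le_segment_01' (C := 2 * L * ‖k‖ ^ 2)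
    (fun s _ => (hd s).hasDerivWithinAt) (fun s hs => ?_)
  · simpa using this
  · have e : hess φ (x + s • k) k + hess φ (x - s • k) k - (2 : ℝ) • hess φ x k =
        (hess φ (x + s • k) - hess φ x) k + (hess φ (x - s • k) - hess φ x) k := by
      simp only [sub_apply, two_smul]; abel
    have hs1 : ‖s • k‖ ≤ ‖k‖ := by
      rw [norm_smul, Real.norm_of_nonneg hs.1]
      exact mul_le_of_le_one_left (norm_nonneg _) hs.2.le
    have b1 : ‖(hess φ (x + s • k) - hess φ x) k‖ ≤ L * ‖k‖ * ‖k‖ := by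
      refine (ContinuousLinearMap.le_opNorm _ _).trans ?_
      gcongr
      refine (hL _ _).trans ?_
      rw [add_sub_cancel_left]
      gcongr
    have b2 : ‖(hess φ (x - s • k) - hess φ x) k‖ ≤ L * ‖k‖ * ‖k‖ := by
      refine (ContinuousLinearMap.le_opNorm _ _).trans ?_
      gcongr
      refine (hL _ _).trans ?_
      rw [sub_sub_cancel_left, norm_neg]
      gcongr
    rw [e]
    refine (norm_add_le _ _).trans ?_
    linarith

theorem norm_fderiv_sub_le {φ : RN N → ℝ} (hφ : IsTestFunction φ) {M : ℝ}
    (hM : ∀ x, ‖hess φ x‖ ≤ M) (x y : RN N) :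
    ‖fderiv ℝ φ x - fderiv ℝ φ y‖ ≤ M * ‖x - y‖ :=
  convex_univ.norm_image_sub_le_of_norm_hasFDerivWithin_le
    (fun z _ => (hφ.hasFDerivAt_fderiv z).hasFDerivWithinAt) (fun z _ => hM z)
    (Set.mem_univ _) (Set.mem_univ _)

/-- Mean value inequality for `s ↦ φ(x+sh) + φ(x-sh) - s² D²φ(x)(h,h)` on `[0,1]`. It turns each
bound on first derivatives into a Taylor bound. -/
theorem abs_secondDiff_sub_le_of_deriv {φ : RN N → ℝ} (hφ : IsTestFunction φ) (x h : RN N) {C : ℝ}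
    (hC : ∀ t ∈ Set.Ico (0 : ℝ) 1,
      |(fderiv ℝ φ (x + t • h) - fderiv ℝ φ (x - t • h) - (2 : ℝ) • hess φ x (t • h)) h| ≤ C) :
    |secondDiff φ x h - hess φ x h h| ≤ C := by
  have hd : ∀ s : ℝ, HasDerivAt
      (fun s : ℝ => φ (x + s • h) + φ (x - s • h) - s ^ 2 * hess φ x h h)
      ((fderiv ℝ φ (x + s • h) - fderiv ℝ φ (x - s • h) - (2 : ℝ) • hess φ x (s • h)) h) s :=
    fun s => by
    have h1 : HasDerivAt (fun s : ℝ => x + s • h) h s := by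
      simpa using ((hasDerivAt_id s).smul_const h).const_add x
    have h2 : HasDerivAt (fun s : ℝ => x - s • h) (-h) s := by
      simpa using ((hasDerivAt_id s).smul_const h).const_sub x
    have h4 := (hφ.hasFDerivAt (x + s • h)).comp_hasDerivAt s h1
    have h5 := (hφ.hasFDerivAt (x - s • h)).comp_hasDerivAt s h2
    refine ((h4.add h5).sub ((hasDerivAt_pow 2 s).mul_const (hess φ x h h))).congr_deriv ?_
    simp
    ring
  have := norm_image_sub_le_of_norm_deriv_le_segment_01'
    (fun s _ => (hd s).hasDerivWithinAt) hC
  simp only [one_smul, zero_smul, Real.norm_eq_abs, add_zero, sub_zero] at this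
  convert this using 2
  unfold secondDiff
  ring

theorem _root_.ContDiff.exists_bound_lipschitz_of_hasCompactSupport {E F : Type*}
    [NormedAddCommGroup E] [NormedSpace ℝ E] [NormedAddCommGroup F] [NormedSpace ℝ F] {f : E → F}
    (hf : ContDiff ℝ ∞ f) (hc : HasCompactSupport f) :
    ∃ C : ℝ, 0 ≤ C ∧ (∀ x, ‖f x‖ ≤ C) ∧ ∀ x y, ‖f x - f y‖ ≤ C * ‖x - y‖ := by
  obtain ⟨M, hM⟩ := hc.exists_bound_of_continuous hf.continuous
  obtain ⟨L, hL⟩ := ContDiff.lipschitzWith_of_hasCompactSupport hc hf (by simp)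
  have hM0 : 0 ≤ M := (norm_nonneg _).trans (hM 0)
  refine ⟨M + L, by positivity, fun x => (hM x).trans (by simp), fun x y => ?_⟩
  have := hL.dist_le_mul x y
  rw [dist_eq_norm, dist_eq_norm] at this
  nlinarith [norm_nonneg (x - y)]

/-- The Lipschitz bound on `D²φ` gives a cubic remainder, good for small `h`; its boundedness gives
a quadratic one, good for large `h`. The minimum records both. -/
theorem IsTestFunction.exists_bounds {φ : RN N → ℝ} (hφ : IsTestFunction φ) :
    ∃ C : ℝ, 0 ≤ C ∧ (∀ x h, |secondDiff φ x h| ≤ C * ‖h‖ ^ 2) ∧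
      (∀ x, ‖hess φ x‖ ≤ C) ∧
      ∀ x h, |secondDiff φ x h - hess φ x h h| ≤ C * (‖h‖ ^ 2 * min 1 ‖h‖) := by
  obtain ⟨M, hM0, hM, hL'⟩ := hφ.contDiff_hess.exists_bound_lipschitz_of_hasCompactSupport
    hφ.hasCompactSupport_hess
  have t1 : ∀ t ∈ Set.Ico (0 : ℝ) 1, ∀ h : RN N, ‖t • h‖ ≤ ‖h‖ := fun t ht h => by
    rw [norm_smul, Real.norm_of_nonneg ht.1]
    exact mul_le_of_le_one_left (norm_nonneg _) ht.2.le
  have b1 : ∀ x h, |secondDiff φ x h - hess φ x h h| ≤ 2 * M * ‖h‖ ^ 3 := fun x h => by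
    refine abs_secondDiff_sub_le_of_deriv hφ x h fun t ht => ?_
    rw [← Real.norm_eq_abs]
    refine (ContinuousLinearMap.le_opNorm _ _).trans ?_
    have := norm_fderiv_add_sub_le hφ hM0 hL' x (t • h)
    calc _ ≤ 2 * M * ‖t • h‖ ^ 2 * ‖h‖ := by gcongr
      _ ≤ 2 * M * ‖h‖ ^ 2 * ‖h‖ := by gcongr; exact t1 t ht h
      _ = _ := by ring
  have b2 : ∀ x h, |secondDiff φ x h - hess φ x h h| ≤ 4 * M * ‖h‖ ^ 2 := fun x h => by
    refine abs_secondDiff_sub_le_of_deriv hφ x h fun t ht => ?_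
    rw [← Real.norm_eq_abs]
    refine (ContinuousLinearMap.le_opNorm _ _).trans ?_
    have e1 : ‖fderiv ℝ φ (x + t • h) - fderiv ℝ φ (x - t • h)‖ ≤ M * (2 * ‖h‖) := by
      refine (norm_fderiv_sub_le hφ hM _ _).trans ?_
      gcongr
      have : x + t • h - (x - t • h) = t • h + t • h := by abel
      rw [this]
      linarith [norm_add_le (t • h) (t • h), t1 t ht h]
    have e2 : ‖(2 : ℝ) • hess φ x (t • h)‖ ≤ 2 * (M * ‖h‖) := by
      rw [norm_smul, Real.norm_two]
      gcongr
      refine (ContinuousLinearMap.le_opNorm _ _).trans ?_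
      gcongr
      · exact hM x
      · exact t1 t ht h
    calc _ ≤ (M * (2 * ‖h‖) + 2 * (M * ‖h‖)) * ‖h‖ := by
          gcongr; exact (norm_sub_le _ _).trans (add_le_add e1 e2)
      _ = _ := by ring
  have b3 : ∀ x h, |hess φ x h h| ≤ M * ‖h‖ ^ 2 := fun x h => by
    rw [← Real.norm_eq_abs]
    refine (ContinuousLinearMap.le_opNorm₂ _ _ _).trans ?_
    rw [mul_assoc, ← sq]
    gcongr
    exact hM x
  -- `5M` is the remainder bound `4M` plus the bound `M` on the Hessian itself, and dominates the
  -- other constants.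
  refine ⟨5 * M, by positivity, fun x h => ?_, fun x => ?_, fun x h => ?_⟩
  · have := abs_sub_abs_le_abs_sub (secondDiff φ x h) (hess φ x h h)
    nlinarith [b2 x h, b3 x h]
  · linarith [hM x]
  · rcases le_total 1 ‖h‖ with h1 | h1
    · rw [min_eq_left h1, mul_one]
      nlinarith [b2 x h, mul_nonneg hM0 (sq_nonneg ‖h‖)]
    · rw [min_eq_right h1]
      have : 0 ≤ M * ‖h‖ ^ 3 := by positivity
      nlinarith [b1 x h]

theorem lintegral_enorm_secondDiff_le (φ : RN N → ℝ) (hφ : Measurable φ) (h : RN N) :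
    ∫⁻ x, ‖secondDiff φ x h‖ₑ ≤ 4 * ∫⁻ x, ‖φ x‖ₑ := by
  have m : Measurable fun x => ‖φ x‖ₑ := hφ.enorm
  calc ∫⁻ x, ‖secondDiff φ x h‖ₑ ≤ ∫⁻ x, (‖φ (x + h)‖ₑ + 2 * ‖φ x‖ₑ + ‖φ (x - h)‖ₑ) := by
        refine lintegral_mono fun x => ?_
        unfold secondDiff
        refine (enorm_add_le _ _).trans (add_le_add_left (enorm_sub_le.trans ?_) _)
        rw [enorm_mul]
        simp [Real.enorm_of_nonneg]
    _ = _ := by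
        rw [lintegral_add_right (g := fun x => ‖φ (x - h)‖ₑ) _ (m.comp (measurable_sub_const h)),
          lintegral_add_right _ (m.const_mul 2), lintegral_const_mul _ m,
          lintegral_add_right_eq_self (fun x => ‖φ x‖ₑ), lintegral_sub_right_eq_self (fun x => ‖φ x‖ₑ)]
        ring

/-- For `‖h‖ ≤ 1` the remainder lives in a fixed ball, where the pointwise bound suffices. For `‖h‖
≥ 1` its support may spread, but translation invariance gives `4‖φ‖₁ + ‖h‖²‖D²φ‖₁`. -/
theorem IsTestFunction.exists_bounds_lintegral {φ : RN N → ℝ} (hφ : IsTestFunction φ) :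
    ∃ C : ℝ, 0 ≤ C ∧ ∀ h, ∫⁻ x, ‖secondDiff φ x h - hess φ x h h‖ₑ ≤
      ENNReal.ofReal (C * (‖h‖ ^ 2 * min 1 ‖h‖)) := by
  obtain ⟨C, hC0, -, -, hC⟩ := hφ.exists_bounds
  obtain ⟨R, hR⟩ := hφ.hasCompactSupport.isCompact.isBounded.subset_closedBall 0
  have hz : ∀ x : RN N, R < ‖x‖ → φ x = 0 := fun x hx => by
    by_contra hne
    have := hR (subset_tsupport _ hne)
    simp at this
    linarith
  have hz2 : ∀ x : RN N, R < ‖x‖ → hess φ x = 0 := fun x hx => by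
    have h1 : x ∉ tsupport φ := fun hmem => by
      have := hR hmem
      simp at this
      linarith
    have h2 : x ∉ tsupport (fderiv ℝ φ) := fun hmem => h1 (tsupport_fderiv_subset ℝ hmem)
    by_contra hne
    exact h2 (support_fderiv_subset ℝ hne)
  set B : Set (RN N) := Metric.closedBall 0 (R + 1)
  set vB := (volume B).toReal
  have hvB : volume B = ENNReal.ofReal vB :=
    (ENNReal.ofReal_toReal measure_closedBall_lt_top.ne).symm
  set a := ∫ x, ‖φ x‖
  set b := ∫ x, ‖hess φ x‖
  have ha : ∫⁻ x, ‖φ x‖ₑ = ENNReal.ofReal a :=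
    (ofReal_integral_norm_eq_lintegral_enorm hφ.integrable).symm
  have hb : ∫⁻ x, ‖hess φ x‖ₑ = ENNReal.ofReal b :=
    (ofReal_integral_norm_eq_lintegral_enorm
      (hφ.contDiff_hess.continuous.integrable_of_hasCompactSupport hφ.hasCompactSupport_hess)).symm
  have ha0 : 0 ≤ a := integral_nonneg fun _ => norm_nonneg _
  have hb0 : 0 ≤ b := integral_nonneg fun x => norm_nonneg (hess φ x)
  have hv0 : 0 ≤ vB := ENNReal.toReal_nonneg
  refine ⟨C * vB + 4 * a + b, by positivity, fun h => ?_⟩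
  rcases le_total ‖h‖ 1 with h1 | h1
  · calc _ = ∫⁻ x in B, ‖secondDiff φ x h - hess φ x h h‖ₑ := by
          symm
          apply setLIntegral_eq_of_support_subset
          intro x hx
          by_contra hxB
          have hx' : R + 1 < ‖x‖ := by simpa [B] using hxB
          apply hx
          have e1 : R < ‖x + h‖ := by
            have := norm_sub_le (x + h) h
            rw [add_sub_cancel_right] at this; linarith
          have e2 : R < ‖x - h‖ := by
            have := norm_add_le (x - h) h
            rw [sub_add_cancel] at this; linarith
          simp [secondDiff, hz _ e1, hz _ e2, hz x (by linarith), hz2 x (by linarith)]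
      _ ≤ ∫⁻ x in B, ENNReal.ofReal (C * (‖h‖ ^ 2 * min 1 ‖h‖)) := by
          refine lintegral_mono fun x => ?_
          rw [← ofReal_norm]
          exact ENNReal.ofReal_le_ofReal (hC x h)
      _ = ENNReal.ofReal (C * (‖h‖ ^ 2 * min 1 ‖h‖) * vB) := by
          rw [setLIntegral_const, hvB, ← ENNReal.ofReal_mul (by positivity)]
      _ ≤ _ := by
          apply ENNReal.ofReal_le_ofReal
          have : 0 ≤ ‖h‖ ^ 2 * min 1 ‖h‖ := by positivity
          nlinarith [mul_nonneg ha0 this, mul_nonneg hb0 this]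
  · have hmeas : Measurable fun x => ‖hess φ x‖ₑ := by
      simp only [← ofReal_norm]
      exact hφ.contDiff_hess.continuous.norm.measurable.ennreal_ofReal
    calc _ ≤ ∫⁻ x, (‖secondDiff φ x h‖ₑ + ‖hess φ x‖ₑ * ENNReal.ofReal (‖h‖ ^ 2)) := by
          refine lintegral_mono fun x => enorm_sub_le.trans (add_le_add_right ?_ _)
          rw [← ofReal_norm, ← ofReal_norm, ← ENNReal.ofReal_mul (norm_nonneg _)]
          apply ENNReal.ofReal_le_ofReal
          refine (ContinuousLinearMap.le_opNorm₂ _ _ _).trans ?_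
          rw [mul_assoc, ← sq]
      _ = (∫⁻ x, ‖secondDiff φ x h‖ₑ) + ENNReal.ofReal b * ENNReal.ofReal (‖h‖ ^ 2) := by
          rw [lintegral_add_right _ (hmeas.mul_const _), lintegral_mul_const _ hmeas, hb]
      _ ≤ 4 * ENNReal.ofReal a + ENNReal.ofReal b * ENNReal.ofReal (‖h‖ ^ 2) := by
          gcongr
          exact (lintegral_enorm_secondDiff_le φ hφ.continuous.measurable h).trans_eq (by rw [ha])
      _ = ENNReal.ofReal (4 * a + b * ‖h‖ ^ 2) := by
          rw [ENNReal.ofReal_add (by positivity) (by positivity), ENNReal.ofReal_mul (by norm_num),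
            ENNReal.ofReal_mul hb0]
          simp
      _ ≤ _ := by
          apply ENNReal.ofReal_le_ofReal
          rw [min_eq_left h1, mul_one]
          have h2 : 1 ≤ ‖h‖ ^ 2 := by nlinarith
          nlinarith [mul_nonneg (mul_nonneg hC0 hv0) (sq_nonneg ‖h‖),
            mul_nonneg ha0 (sub_nonneg.2 h2)]

/-! ### Consistency of the non-local Hessian -/

/-- The first truncated moment of `ρ`. -/
def truncMoment (ρ : RN N → ℝ) : ℝ := ∫ h : RN N, min 1 ‖h‖ * ρ h

theorem IsRadialMollifier.integrable_truncMoment {ρ : RN N → ℝ} (hρ : IsRadialMollifier ρ) :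
    Integrable (fun h : RN N => min 1 ‖h‖ * ρ h) :=
  integrable_mul_of_bound hρ.integrable (by fun_prop) (C := 1) fun h => by
    rw [abs_of_nonneg (by positivity)]; exact min_le_left _ _

theorem IsRadialMollifier.truncMoment_nonneg {ρ : RN N → ℝ} (hρ : IsRadialMollifier ρ) :
    0 ≤ truncMoment ρ :=
  integral_nonneg fun h => mul_nonneg (by positivity) (hρ.nonneg h)

/-- Split at `‖h‖ = ε/2`: inside, the factor is at most `ε/2` against unit mass; outside, it is at
most one against the vanishing tail. -/
theorem IsRadialMollifierSeq.tendsto_truncMoment {ρ : ℕ → RN N → ℝ}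
    (hρ : IsRadialMollifierSeq ρ) : Tendsto (fun n => truncMoment (ρ n)) atTop (𝓝 0) := by
  rw [Metric.tendsto_atTop]
  intro ε hε
  obtain ⟨n₀, hn₀⟩ := Metric.tendsto_atTop.1 (hρ.tail (ε / 2) (by positivity)) (ε / 2)
    (by positivity)
  refine ⟨n₀, fun n hn => ?_⟩
  have hr := hρ.isRadialMollifier n
  have h1 := hn₀ n hn
  rw [Real.dist_0_eq_abs] at h1 ⊢
  rw [abs_of_nonneg hr.truncMoment_nonneg]
  have hm : MeasurableSet {x : RN N | ε / 2 < ‖x‖} := measurableSet_lt measurable_const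
    measurable_norm
  calc truncMoment (ρ n) ≤ ∫ h, (ε / 2 * ρ n h + {x : RN N | ε / 2 < ‖x‖}.indicator (ρ n) h) := by
        refine integral_mono hr.integrable_truncMoment
          ((hr.integrable.const_mul _).add (hr.integrable.indicator hm)) fun h => ?_
        simp only
        have h0 := hr.nonneg h
        by_cases hh : ε / 2 < ‖h‖
        · rw [Set.indicator_of_mem (by simpa using hh)]
          nlinarith [min_le_left 1 ‖h‖, mul_nonneg hε.le h0]
        · rw [Set.indicator_of_notMem (by simpa using hh), add_zero]
          exact mul_le_mul_of_nonneg_right ((min_le_right _ _).trans (not_lt.1 hh)) h0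
    _ = ε / 2 + ∫ x in {x : RN N | ε / 2 < ‖x‖}, ρ n x := by
        rw [integral_add (hr.integrable.const_mul _) (hr.integrable.indicator hm),
          integral_const_mul, hr.integral_eq_one, integral_indicator hm, mul_one]
    _ < ε := by linarith [(abs_lt.1 h1).2]

theorem bilin_eq_sum (A : RN N →L[ℝ] RN N →L[ℝ] ℝ) (h : RN N) :
    A h h = ∑ k, ∑ l, inner ℝ h (EuclideanSpace.single k (1 : ℝ)) *
      inner ℝ h (EuclideanSpace.single l (1 : ℝ)) *
        A (EuclideanSpace.single k 1) (EuclideanSpace.single l 1) := by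
  have e : h = ∑ k, h k • EuclideanSpace.single k (1 : ℝ) := by
    ext m
    simp [Finset.sum_apply, Pi.single_apply]
  conv_lhs => rw [e]
  simp only [map_sum, map_smul, _root_.sum_apply, _root_.smul_apply, smul_eq_mul, Finset.mul_sum]
  rw [Finset.sum_comm]
  refine Finset.sum_congr rfl fun k _ => Finset.sum_congr rfl fun l _ => ?_
  simp [EuclideanSpace.inner_single_right]
  ring

/-- The second order consistency identity of the weight in the non-local Hessian. -/
theorem integral_bilin_hessWeight (hN : 1 ≤ N) {ρ : RN N → ℝ} (hρ : IsRadialMollifier ρ)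
    (A : RN N →L[ℝ] RN N →L[ℝ] ℝ) (hA : ∀ v w, A v w = A w v) (i j : Fin N) :
    (N : ℝ) * ((N : ℝ) + 2) / 2 * ∫ h : RN N, A h h / ‖h‖ ^ 2 * hessWeight i j h * ρ h =
      A (EuclideanSpace.single i 1) (EuclideanSpace.single j 1) := by
  have hN0 : (N : ℝ) ≠ 0 := by positivity
  have hN2 : (N : ℝ) + 2 ≠ 0 := by positivity
  have key : ∀ h : RN N, A h h / ‖h‖ ^ 2 * hessWeight i j h * ρ h =
      ∑ k, ∑ l, A (EuclideanSpace.single k 1) (EuclideanSpace.single l 1) *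
        (inner ℝ h (EuclideanSpace.single k (1 : ℝ)) * inner ℝ h (EuclideanSpace.single l (1 : ℝ)) *
          inner ℝ h (EuclideanSpace.single i (1 : ℝ)) *
          inner ℝ h (EuclideanSpace.single j (1 : ℝ)) / ‖h‖ ^ 4 * ρ h -
        (if i = j then ((N : ℝ) + 2)⁻¹ else 0) *
          (inner ℝ h (EuclideanSpace.single k (1 : ℝ)) *
            inner ℝ h (EuclideanSpace.single l (1 : ℝ)) / ‖h‖ ^ 2 * ρ h)) := by
    intro h
    rcases eq_or_ne h 0 with rfl | hh
    · simp
    have hp : ‖h‖ ≠ 0 := norm_ne_zero_iff.2 hh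
    have hw : hessWeight i j h = inner ℝ h (EuclideanSpace.single i (1 : ℝ)) *
        inner ℝ h (EuclideanSpace.single j (1 : ℝ)) / ‖h‖ ^ 2 -
          (if i = j then ((N : ℝ) + 2)⁻¹ else 0) := by
      unfold hessWeight
      split_ifs
      · simp [EuclideanSpace.inner_single_right]
        field_simp
      · simp [EuclideanSpace.inner_single_right]
    rw [bilin_eq_sum A h, hw, Finset.sum_div, Finset.sum_mul, Finset.sum_mul]
    refine Finset.sum_congr rfl fun k _ => ?_
    rw [Finset.sum_div, Finset.sum_mul, Finset.sum_mul]
    refine Finset.sum_congr rfl fun l _ => ?_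
    field_simp
  have i2 : ∀ k l : Fin N, Integrable fun h : RN N =>
      inner ℝ h (EuclideanSpace.single k (1 : ℝ)) *
            inner ℝ h (EuclideanSpace.single l (1 : ℝ)) / ‖h‖ ^ 2 * ρ h := fun k l => by
    refine integrable_mul_of_bound hρ.integrable (by fun_prop) (C := 1) fun h => ?_
    rcases eq_or_ne h 0 with rfl | hh
    · simp
    have hp : 0 < ‖h‖ := norm_pos_iff.2 hh
    rw [abs_div, abs_of_pos (pow_pos hp 2), div_le_iff₀ (by positivity), abs_mul, one_mul, sq]
    have b : ∀ k, |inner ℝ h (EuclideanSpace.single k (1 : ℝ))| ≤ ‖h‖ := fun k => by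
      simpa using abs_real_inner_le_norm h (EuclideanSpace.single k (1 : ℝ))
    exact mul_le_mul (b k) (b l) (abs_nonneg _) hp.le
  have i3 : ∀ k l : Fin N, Integrable fun h : RN N =>
      A (EuclideanSpace.single k 1) (EuclideanSpace.single l 1) *
        (inner ℝ h (EuclideanSpace.single k (1 : ℝ)) * inner ℝ h (EuclideanSpace.single l (1 : ℝ)) *
          inner ℝ h (EuclideanSpace.single i (1 : ℝ)) *
          inner ℝ h (EuclideanSpace.single j (1 : ℝ)) / ‖h‖ ^ 4 * ρ h -
        (if i = j then ((N : ℝ) + 2)⁻¹ else 0) *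
          (inner ℝ h (EuclideanSpace.single k (1 : ℝ)) *
            inner ℝ h (EuclideanSpace.single l (1 : ℝ)) / ‖h‖ ^ 2 * ρ h)) := fun k l =>
    ((integrable_quartic hρ.integrable _ _ _ _).sub ((i2 k l).const_mul _)).const_mul _
  -- The `δ_kl δ_ij` part of the fourth moment cancels against the correction, whose second moment
  -- is `δ_kl / N`. What is left sums to `A_ij + A_ji`, which explains the factor `1/2` and the need
  -- for symmetry.
  have e : ∀ k l : Fin N, ∫ h : RN N,
      A (EuclideanSpace.single k 1) (EuclideanSpace.single l 1) *
        (inner ℝ h (EuclideanSpace.single k (1 : ℝ)) * inner ℝ h (EuclideanSpace.single l (1 : ℝ)) *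
          inner ℝ h (EuclideanSpace.single i (1 : ℝ)) *
          inner ℝ h (EuclideanSpace.single j (1 : ℝ)) / ‖h‖ ^ 4 * ρ h -
        (if i = j then ((N : ℝ) + 2)⁻¹ else 0) *
          (inner ℝ h (EuclideanSpace.single k (1 : ℝ)) *
            inner ℝ h (EuclideanSpace.single l (1 : ℝ)) / ‖h‖ ^ 2 * ρ h)) =
      ((N : ℝ) * (N + 2))⁻¹ * (A (EuclideanSpace.single k 1) (EuclideanSpace.single l 1) *
        ((if k = i then 1 else 0) * (if l = j then 1 else 0) +
          (if k = j then 1 else 0) * (if l = i then 1 else 0))) := fun k l => by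
    rw [integral_const_mul, integral_sub (integrable_quartic hρ.integrable _ _ _ _)
      ((i2 k l).const_mul _), integral_const_mul, integral_inner_mul_inner hN hρ]
    have := quartic_eq hN hρ (EuclideanSpace.single k (1 : ℝ)) (EuclideanSpace.single l (1 : ℝ))
      (EuclideanSpace.single i (1 : ℝ)) (EuclideanSpace.single j (1 : ℝ))
    unfold quartic at this
    have hin : ∀ p q : Fin N, inner ℝ (EuclideanSpace.single p (1 : ℝ))
        (EuclideanSpace.single q (1 : ℝ)) = if p = q then (1 : ℝ) else 0 := fun p q => by
      simp [EuclideanSpace.inner_single_right, eq_comm]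
    have hif : (if i = j then ((N : ℝ) + 2)⁻¹ else 0) =
        ((N : ℝ) + 2)⁻¹ * (if i = j then 1 else 0) := by simp
    rw [this, hin, hin, hin, hin, hin, hin, hif]
    field_simp
    ring
  rw [integral_congr_ae (Eventually.of_forall key), integral_finsetSum _
    fun k _ => integrable_finsetSum _ fun l _ => i3 k l,
    Finset.sum_congr rfl fun k _ => integral_finsetSum _ fun l _ => i3 k l,
    Finset.sum_congr rfl fun k _ => Finset.sum_congr rfl fun l _ => e k l]
  simp only [mul_add, ← Finset.mul_sum, Finset.sum_add_distrib]
  simp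
  rw [hA (EuclideanSpace.single j 1)]
  field_simp
  ring

theorem integrable_secondDiff {ρ : RN N → ℝ} (hρ : IsRadialMollifier ρ) {φ : RN N → ℝ}
    (hφ : IsTestFunction φ) (i j : Fin N) (x : RN N) :
    Integrable fun h => secondDiff φ x h / ‖h‖ ^ 2 * hessWeight i j h * ρ h := by
  obtain ⟨C, hC0, hC, -, -⟩ := hφ.exists_bounds
  have := hφ.continuous.measurable
  have := measurable_hessWeight (N := N) i j
  refine integrable_mul_of_bound hρ.integrable ?_ (C := C * 2) fun h => ?_
  · unfold secondDiff
    fun_prop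
  · rw [abs_mul]
    refine mul_le_mul ?_ (abs_hessWeight_le i j h) (abs_nonneg _) hC0
    rw [abs_div, abs_of_nonneg (sq_nonneg ‖h‖)]
    exact div_le_of_le_mul₀ (by positivity) hC0 (hC x h)

theorem integrable_hess {ρ : RN N → ℝ} (hρ : IsRadialMollifier ρ) {φ : RN N → ℝ}
    (hφ : IsTestFunction φ) (i j : Fin N) (x : RN N) :
    Integrable fun h => hess φ x h h / ‖h‖ ^ 2 * hessWeight i j h * ρ h := by
  obtain ⟨C, hC0, -, hC, -⟩ := hφ.exists_bounds
  have := measurable_hessWeight (N := N) i j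
  refine integrable_mul_of_bound hρ.integrable ?_ (C := C * 2) fun h => ?_
  · have : Measurable fun h => hess φ x h h :=
      (((hess φ x).continuous).clm_apply continuous_id).measurable
    fun_prop
  · rw [abs_mul]
    refine mul_le_mul ?_ (abs_hessWeight_le i j h) (abs_nonneg _) hC0
    rw [abs_div, abs_of_nonneg (sq_nonneg ‖h‖)]
    refine div_le_of_le_mul₀ (by positivity) hC0 ?_
    rw [← Real.norm_eq_abs]
    refine (ContinuousLinearMap.le_opNorm₂ _ _ _).trans ?_
    rw [mul_assoc, ← sq]
    gcongr
    exact hC x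

/-- Exactness on quadratic forms puts the Hessian under the same integral, leaving only the Taylor
remainder. -/
theorem nonlocalHess_sub_eq (hN : 1 ≤ N) {ρ : RN N → ℝ} (hρ : IsRadialMollifier ρ) {φ : RN N → ℝ}
    (hφ : IsTestFunction φ) (i j : Fin N) (x : RN N) :
    nonlocalHess ρ i j φ x - partialDeriv i (partialDeriv j φ) x = (N : ℝ) * ((N : ℝ) + 2) / 2 *
      ∫ h : RN N, (secondDiff φ x h - hess φ x h h) / ‖h‖ ^ 2 * hessWeight i j h * ρ h := by
  rw [hφ.partialDeriv_partialDeriv,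
    ← integral_bilin_hessWeight hN hρ (hess φ x) (hφ.hess_symm x) i j, nonlocalHess_eq, ← mul_sub,
    ← integral_sub (integrable_secondDiff hρ hφ i j x) (integrable_hess hρ hφ i j x)]
  congr 2
  ext h
  ring

theorem enorm_remainder_mul_le {ρ : RN N → ℝ} (hρ : IsRadialMollifier ρ) (i j : Fin N) (r : ℝ)
    (h : RN N) : ‖r / ‖h‖ ^ 2 * hessWeight i j h * ρ h‖ₑ ≤
      ‖r‖ₑ * ENNReal.ofReal (2 / ‖h‖ ^ 2 * ρ h) := by
  have h0 := hρ.nonneg h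
  rw [← ofReal_norm, ← ofReal_norm, ← ENNReal.ofReal_mul (norm_nonneg _)]
  apply ENNReal.ofReal_le_ofReal
  rw [norm_mul, norm_mul, norm_div, Real.norm_of_nonneg h0, Real.norm_of_nonneg (sq_nonneg ‖h‖)]
  calc _ ≤ ‖r‖ / ‖h‖ ^ 2 * 2 * ρ h := by
        gcongr; exact abs_hessWeight_le i j h
    _ = _ := by ring

theorem ofReal_mul_ofReal_le (ρ : RN N → ℝ) {C : ℝ} (hC : 0 ≤ C)
    (h : RN N) : ENNReal.ofReal (C * (‖h‖ ^ 2 * min 1 ‖h‖)) * ENNReal.ofReal (2 / ‖h‖ ^ 2 * ρ h) ≤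
      ENNReal.ofReal (2 * C * (min 1 ‖h‖ * ρ h)) := by
  rw [← ENNReal.ofReal_mul (by positivity)]
  apply ENNReal.ofReal_le_ofReal
  rcases eq_or_ne h 0 with rfl | hh
  · simp
  have hp : ‖h‖ ≠ 0 := norm_ne_zero_iff.2 hh
  apply le_of_eq
  field_simp

theorem lintegral_truncMoment {ρ : RN N → ℝ} (hρ : IsRadialMollifier ρ) {C : ℝ} (hC : 0 ≤ C) :
    ∫⁻ h : RN N, ENNReal.ofReal (2 * C * (min 1 ‖h‖ * ρ h)) =
      ENNReal.ofReal (2 * C * truncMoment ρ) := by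
  rw [truncMoment, ← integral_const_mul, ofReal_integral_eq_lintegral_ofReal
    (hρ.integrable_truncMoment.const_mul _) (Eventually.of_forall fun h => by
      have := hρ.nonneg h
      positivity)]

/-- The constant depends on `φ` but not on `ρ`, so the bound becomes uniform convergence along a
mollifier sequence; the lower bound uses this. -/
theorem exists_nonlocalHess_sub_le (hN : 1 ≤ N) {φ : RN N → ℝ} (hφ : IsTestFunction φ) :
    ∃ C : ℝ, 0 ≤ C ∧ ∀ ρ : RN N → ℝ, IsRadialMollifier ρ → ∀ i j x,
      |nonlocalHess ρ i j φ x - partialDeriv i (partialDeriv j φ) x| ≤ C * truncMoment ρ := by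
  obtain ⟨C, hC0, -, -, hC⟩ := hφ.exists_bounds
  refine ⟨(N : ℝ) * ((N : ℝ) + 2) / 2 * (2 * C), by positivity, fun ρ hρ i j x => ?_⟩
  have hm := hρ.truncMoment_nonneg
  rw [nonlocalHess_sub_eq hN hρ hφ, ← Real.norm_eq_abs, norm_mul,
    Real.norm_of_nonneg (by positivity), mul_assoc]
  gcongr
  rw [← ENNReal.ofReal_le_ofReal_iff (by positivity), ofReal_norm]
  refine (enorm_integral_le_lintegral_enorm _).trans ?_
  rw [← lintegral_truncMoment hρ hC0]
  refine lintegral_mono fun h => (enorm_remainder_mul_le hρ i j _ h).trans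
    (le_trans ?_ (ofReal_mul_ofReal_le ρ hC0 h))
  gcongr
  rw [← ofReal_norm]
  exact ENNReal.ofReal_le_ofReal (hC x h)

theorem aestronglyMeasurable_remainder {ρ : RN N → ℝ} (hρ : IsRadialMollifier ρ) {φ : RN N → ℝ}
    (hφ : IsTestFunction φ) (i j : Fin N) :
    AEStronglyMeasurable (fun p : RN N × RN N =>
      (secondDiff φ p.1 p.2 - hess φ p.1 p.2 p.2) / ‖p.2‖ ^ 2 * hessWeight i j p.2 * ρ p.2)
      (volume.prod volume) := by
  have h1 := hφ.continuous.measurable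
  have h2 := measurable_hessWeight (N := N) i j
  have h3 : Measurable fun p : RN N × RN N => hess φ p.1 p.2 p.2 :=
    (((hφ.contDiff_hess.continuous.comp continuous_fst).clm_apply continuous_snd).clm_apply
      continuous_snd).measurable
  refine AEStronglyMeasurable.mul (Measurable.aestronglyMeasurable ?_)
    hρ.integrable.aestronglyMeasurable.comp_snd
  unfold secondDiff
  fun_prop

/-- Tonelli reduces the claim to the `L¹` norm in `x` of the remainder at fixed `h`. This version
serves the recovery sequence, where the error is convolved with `u`. -/
theorem exists_lintegral_nonlocalHess_sub_le (hN : 1 ≤ N) {φ : RN N → ℝ} (hφ : IsTestFunction φ) :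
    ∃ C : ℝ, 0 ≤ C ∧ ∀ ρ : RN N → ℝ, IsRadialMollifier ρ → ∀ i j,
      ∫⁻ x, ‖nonlocalHess ρ i j φ x - partialDeriv i (partialDeriv j φ) x‖ₑ ≤
        ENNReal.ofReal (C * truncMoment ρ) := by
  obtain ⟨C, hC0, hC⟩ := hφ.exists_bounds_lintegral
  refine ⟨(N : ℝ) * ((N : ℝ) + 2) / 2 * (2 * C), by positivity, fun ρ hρ i j => ?_⟩
  have hm := aestronglyMeasurable_remainder hρ hφ i j
  simp only [nonlocalHess_sub_eq hN hρ hφ, enorm_mul]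
  rw [lintegral_const_mul' _ _ (by simp), mul_assoc, ENNReal.ofReal_mul (by positivity),
    ← lintegral_truncMoment hρ hC0, Real.enorm_of_nonneg (by positivity)]
  refine mul_le_mul' le_rfl ?_
  calc _ ≤ ∫⁻ x, ∫⁻ h, ‖(secondDiff φ x h - hess φ x h h) / ‖h‖ ^ 2 * hessWeight i j h * ρ h‖ₑ :=
        lintegral_mono fun x => enorm_integral_le_lintegral_enorm _
    _ = ∫⁻ h, ∫⁻ x, ‖(secondDiff φ x h - hess φ x h h) / ‖h‖ ^ 2 * hessWeight i j h * ρ h‖ₑ :=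
        lintegral_lintegral_swap hm.enorm
    _ ≤ _ := by
        refine lintegral_mono fun h => le_trans ?_ (ofReal_mul_ofReal_le ρ hC0 h)
        refine (lintegral_mono fun x => enorm_remainder_mul_le hρ i j _ h).trans ?_
        rw [lintegral_mul_const' _ _ ENNReal.ofReal_ne_top]
        gcongr
        exact hC h

theorem continuous_nonlocalHess {ρ : RN N → ℝ} (hρ : IsRadialMollifier ρ) {φ : RN N → ℝ}
    (hφ : IsTestFunction φ) (i j : Fin N) : Continuous (nonlocalHess ρ i j φ) := by
  obtain ⟨C, hC0, hC, -, -⟩ := hφ.exists_bounds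
  simp only [funext fun x => nonlocalHess_eq ρ i j φ x]
  refine continuous_const.mul (continuous_of_dominated (bound := fun h => C * 2 * ρ h)
    (fun x => (integrable_secondDiff hρ hφ i j x).aestronglyMeasurable)
    (fun x => Eventually.of_forall fun h => ?_) (hρ.integrable.const_mul _)
    (Eventually.of_forall fun h => ?_))
  · have h0 := hρ.nonneg h
    rw [norm_mul, norm_mul, Real.norm_of_nonneg h0]
    gcongr
    · rw [norm_div, Real.norm_of_nonneg (sq_nonneg ‖h‖)]
      exact div_le_of_le_mul₀ (by positivity) hC0 (hC x h)
    · exact abs_hessWeight_le i j h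
  · have := hφ.continuous
    unfold secondDiff
    fun_prop

theorem integrable_nonlocalHess (hN : 1 ≤ N) {ρ : RN N → ℝ} (hρ : IsRadialMollifier ρ)
    {φ : RN N → ℝ} (hφ : IsTestFunction φ) (i j : Fin N) : Integrable (nonlocalHess ρ i j φ) := by
  obtain ⟨C, hC0, hC⟩ := exists_lintegral_nonlocalHess_sub_le hN hφ
  have hd := ((hφ.partialDeriv j).partialDeriv i)
  have : Integrable fun x => nonlocalHess ρ i j φ x - partialDeriv i (partialDeriv j φ) x :=
    ⟨((continuous_nonlocalHess hρ hφ i j).sub hd.continuous).aestronglyMeasurable,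
      (hC ρ hρ i j).trans_lt ENNReal.ofReal_lt_top⟩
  refine (this.add hd.integrable).congr (Eventually.of_forall fun x => ?_)
  simp

theorem exists_nonlocalHess_le (hN : 1 ≤ N) {ρ : RN N → ℝ} (hρ : IsRadialMollifier ρ)
    {φ : RN N → ℝ} (hφ : IsTestFunction φ) (i j : Fin N) :
    ∃ C, ∀ x, |nonlocalHess ρ i j φ x| ≤ C := by
  obtain ⟨C, hC0, hC⟩ := exists_nonlocalHess_sub_le hN hφ
  have hd := (hφ.partialDeriv j).partialDeriv i
  obtain ⟨D, hD⟩ := hd.hasCompactSupport.exists_bound_of_continuous hd.continuous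
  refine ⟨C * truncMoment ρ + D, fun x => ?_⟩
  have h1 := hC ρ hρ i j x
  have h2 := hD x
  rw [Real.norm_eq_abs] at h2
  have := abs_sub_abs_le_abs_sub (nonlocalHess ρ i j φ x) (partialDeriv i (partialDeriv j φ) x)
  linarith

/-! ### Symmetries of the non-local Hessian -/

theorem nonlocalHess_comp_sub_const (ρ : RN N → ℝ) (i j : Fin N) (φ : RN N → ℝ) (x y : RN N) :
    nonlocalHess ρ i j (fun z => φ (z - y)) x = nonlocalHess ρ i j φ (x - y) := by
  simp only [nonlocalHess, sub_add_eq_add_sub, sub_right_comm x y]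

theorem IsTestFunction.comp_sub_const {φ : RN N → ℝ} (hφ : IsTestFunction φ) (y : RN N) :
    IsTestFunction fun z => φ (z - y) where
  contDiff := hφ.contDiff.comp (contDiff_id.sub contDiff_const)
  hasCompactSupport := by
    have := hφ.hasCompactSupport.comp_homeomorph (Homeomorph.subRight y)
    exact this

theorem IsTestFunction.comp_const_sub {φ : RN N → ℝ} (hφ : IsTestFunction φ) (y : RN N) :
    IsTestFunction fun z => φ (y - z) where
  contDiff := hφ.contDiff.comp (contDiff_const.sub contDiff_id)
  hasCompactSupport := by
    have := hφ.hasCompactSupport.comp_homeomorph (Homeomorph.subLeft y)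
    exact this

theorem integral_mul_secondDiff {φ ψ : RN N → ℝ} (hφ : IsTestFunction φ) (hψ : IsTestFunction ψ)
    (h : RN N) : ∫ x, ψ x * secondDiff φ x h = ∫ x, secondDiff ψ x h * φ x := by
  obtain ⟨C, hC⟩ := hψ.hasCompactSupport.exists_bound_of_continuous hψ.continuous
  have I1 : Integrable fun x => ψ x * φ (x + h) :=
    (hφ.integrable.comp_add_right h).bdd_mul hψ.continuous.aestronglyMeasurable
      (Eventually.of_forall hC)
  have I2 : Integrable fun x => ψ x * φ x :=
    hφ.integrable.bdd_mul hψ.continuous.aestronglyMeasurable (Eventually.of_forall hC)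
  have I3 : Integrable fun x => ψ x * φ (x - h) :=
    (hφ.integrable.comp_sub_right h).bdd_mul hψ.continuous.aestronglyMeasurable
      (Eventually.of_forall hC)
  have I4 : Integrable fun x => ψ (x + h) * φ x := by simpa using I3.comp_add_right h
  have I5 : Integrable fun x => ψ (x - h) * φ x := by simpa using I1.comp_sub_right h
  have e1 : ∫ x, ψ x * φ (x - h) = ∫ x, ψ (x + h) * φ x := by
    simpa using (integral_add_right_eq_self (fun x => ψ x * φ (x - h)) h).symm
  have e2 : ∫ x, ψ x * φ (x + h) = ∫ x, ψ (x - h) * φ x := by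
    simpa using (integral_sub_right_eq_self (fun x => ψ x * φ (x + h)) h).symm
  calc _ = ∫ x, (ψ x * φ (x + h) - 2 * (ψ x * φ x) + ψ x * φ (x - h)) := by
        congr 1; ext x; unfold secondDiff; ring
    _ = (∫ x, ψ (x - h) * φ x) - 2 * (∫ x, ψ x * φ x) + ∫ x, ψ (x + h) * φ x := by
        rw [integral_add (f := fun x => ψ x * φ (x + h) - 2 * (ψ x * φ x)) (I1.sub (I2.const_mul 2)) I3, integral_sub I1 (I2.const_mul 2),
          integral_const_mul, e1, e2]
    _ = ∫ x, (ψ (x - h) * φ x - 2 * (ψ x * φ x) + ψ (x + h) * φ x) := by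
        rw [integral_add (f := fun x => ψ (x - h) * φ x - 2 * (ψ x * φ x)) (I5.sub (I2.const_mul 2)) I4, integral_sub I5 (I2.const_mul 2),
          integral_const_mul]
    _ = _ := by
        congr 1; ext x; unfold secondDiff; ring

theorem integrable_mul_secondDiff {ρ : RN N → ℝ} (hρ : IsRadialMollifier ρ) {φ ψ : RN N → ℝ}
    (hφ : IsTestFunction φ) (hψ : IsTestFunction ψ) (i j : Fin N) :
    Integrable (fun p : RN N × RN N =>
      ψ p.1 * (secondDiff φ p.1 p.2 / ‖p.2‖ ^ 2 * hessWeight i j p.2 * ρ p.2))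
      (volume.prod volume) := by
  obtain ⟨C, hC0, hC, -, -⟩ := hφ.exists_bounds
  have h1 := hφ.continuous.measurable
  have h2 := measurable_hessWeight (N := N) i j
  have : Integrable (fun p : RN N × RN N => (secondDiff φ p.1 p.2 / ‖p.2‖ ^ 2 *
      hessWeight i j p.2) * (ψ p.1 * ρ p.2)) (volume.prod volume) := by
    refine (hψ.integrable.mul_prod hρ.integrable).bdd_mul (c := C * 2)
      (Measurable.aestronglyMeasurable ?_) (Eventually.of_forall fun p => ?_)
    · unfold secondDiff
      fun_prop
    · rw [norm_mul]
      refine mul_le_mul ?_ (abs_hessWeight_le i j _) (norm_nonneg _) hC0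
      rw [norm_div, Real.norm_of_nonneg (sq_nonneg ‖p.2‖)]
      exact div_le_of_le_mul₀ (by positivity) hC0 (hC _ _)
  refine this.congr (Eventually.of_forall fun p => ?_)
  simp only
  ring

/-- At each fixed `h` the second difference is self-adjoint by translation invariance, and Fubini
integrates this against the weight. -/
theorem integral_mul_nonlocalHess {ρ : RN N → ℝ} (hρ : IsRadialMollifier ρ) {φ ψ : RN N → ℝ}
    (hφ : IsTestFunction φ) (hψ : IsTestFunction ψ) (i j : Fin N) :
    ∫ x, ψ x * nonlocalHess ρ i j φ x = ∫ x, nonlocalHess ρ i j ψ x * φ x := by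
  have swap : ∀ {φ ψ : RN N → ℝ}, IsTestFunction φ → IsTestFunction ψ →
      ∫ x, ψ x * nonlocalHess ρ i j φ x = (N : ℝ) * ((N : ℝ) + 2) / 2 * ∫ h,
        (∫ x, ψ x * secondDiff φ x h) * (1 / ‖h‖ ^ 2 * hessWeight i j h * ρ h) := by
    intro φ ψ hφ hψ
    calc _ = (N : ℝ) * ((N : ℝ) + 2) / 2 * ∫ x, ∫ h,
          ψ x * (secondDiff φ x h / ‖h‖ ^ 2 * hessWeight i j h * ρ h) := by
          rw [← integral_const_mul]
          congr 1
          ext x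
          rw [nonlocalHess_eq, integral_const_mul]
          ring
      _ = _ := by
          rw [integral_integral_swap (integrable_mul_secondDiff hρ hφ hψ i j)]
          congr 2
          ext h
          rw [← integral_mul_const]
          congr 1
          ext x
          ring
  rw [swap hφ hψ]
  simp only [mul_comm (nonlocalHess ρ i j ψ _)]
  rw [swap hψ hφ]
  simp only [integral_mul_secondDiff hφ hψ, mul_comm (φ _)]

/-! ### Mollification -/

/-- The convolution of two real functions. -/
def conv (u η : RN N → ℝ) : RN N → ℝ :=
  MeasureTheory.convolution u η (ContinuousLinearMap.mul ℝ ℝ) volume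

theorem conv_apply (u η : RN N → ℝ) (x : RN N) : conv u η x = ∫ y, u y * η (x - y) := rfl

theorem integrable_conv_integrand {u η : RN N → ℝ} (hu : Integrable u) (hη : Integrable η) :
    Integrable (fun p : RN N × RN N => u p.2 * η (p.1 - p.2)) (volume.prod volume) :=
  hu.convolution_integrand (ContinuousLinearMap.mul ℝ ℝ) hη

theorem integrable_conv {u η : RN N → ℝ} (hu : Integrable u) (hη : Integrable η) :
    Integrable (conv u η) :=
  hu.integrable_convolution (ContinuousLinearMap.mul ℝ ℝ) hη

theorem lintegral_enorm_conv_le {u η : RN N → ℝ} (hu : Integrable u) (hη : Integrable η) :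
    ∫⁻ x, ‖conv u η x‖ₑ ≤ (∫⁻ x, ‖u x‖ₑ) * ∫⁻ x, ‖η x‖ₑ := by
  calc _ ≤ ∫⁻ x, ∫⁻ y, ‖u y * η (x - y)‖ₑ :=
        lintegral_mono fun x => enorm_integral_le_lintegral_enorm _
    _ = ∫⁻ y, ∫⁻ x, ‖u y * η (x - y)‖ₑ :=
        lintegral_lintegral_swap (integrable_conv_integrand hu hη).aestronglyMeasurable.enorm
    _ = ∫⁻ y, ‖u y‖ₑ * ∫⁻ x, ‖η x‖ₑ := by
        refine lintegral_congr fun y => ?_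
        simp only [enorm_mul]
        rw [lintegral_const_mul' _ _ (by simp), lintegral_sub_right_eq_self (fun x => ‖η x‖ₑ)]
    _ = _ := lintegral_mul_const'' _ hu.aestronglyMeasurable.enorm

theorem conv_sub_right {u η ζ : RN N → ℝ} (x : RN N)
    (hη : Integrable fun y => u y * η (x - y)) (hζ : Integrable fun y => u y * ζ (x - y)) :
    conv u η x - conv u ζ x = conv u (fun z => η z - ζ z) x := by
  rw [conv_apply, conv_apply, conv_apply, ← integral_sub hη hζ]
  congr 1
  ext y
  ring

theorem integrable_mul_comp_sub {u η : RN N → ℝ} (hu : Integrable u) (hη : Continuous η) {C : ℝ}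
    (hC : ∀ x, |η x| ≤ C) (x : RN N) : Integrable fun y => u y * η (x - y) :=
  hu.mul_bdd (c := C) (hη.comp (continuous_sub_left x)).aestronglyMeasurable
    (Eventually.of_forall fun _ => hC _)

theorem IsTestFunction.exists_abs_le {φ : RN N → ℝ} (hφ : IsTestFunction φ) :
    ∃ C, ∀ x, |φ x| ≤ C :=
  hφ.hasCompactSupport.exists_bound_of_continuous hφ.continuous

theorem IsTestFunction.integrable_mul_comp_sub {u η : RN N → ℝ} (hη : IsTestFunction η)
    (hu : Integrable u) (x : RN N) : Integrable fun y => u y * η (x - y) :=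
  have ⟨_, hC⟩ := hη.exists_abs_le
  NonlocalHessian.integrable_mul_comp_sub hu hη.continuous hC x

theorem hasFDerivAt_conv {u η : RN N → ℝ} (hu : Integrable u) (hη : IsTestFunction η)
    (x : RN N) : HasFDerivAt (conv u η) (MeasureTheory.convolution u (fderiv ℝ η)
      ((ContinuousLinearMap.mul ℝ ℝ).precompR (RN N)) volume x) x :=
  hη.hasCompactSupport.hasFDerivAt_convolution_right _ hu.locallyIntegrable
    (hη.contDiff.of_le (by simp)) x

theorem partialDeriv_conv {u η : RN N → ℝ} (hu : Integrable u) (hη : IsTestFunction η)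
    (i : Fin N) (x : RN N) : partialDeriv i (conv u η) x = conv u (partialDeriv i η) x := by
  rw [partialDeriv, (hasFDerivAt_conv hu hη x).fderiv]
  exact convolution_precompR_apply _ hu.locallyIntegrable (hη.hasCompactSupport.fderiv ℝ)
    hη.contDiff_fderiv.continuous x _

theorem contDiff_conv {u η : RN N → ℝ} (hu : Integrable u) (hη : IsTestFunction η) :
    ContDiff ℝ ∞ (conv u η) :=
  hη.hasCompactSupport.contDiff_convolution_right _ hu.locallyIntegrable hη.contDiff

theorem integral_conv_mul {u η g : RN N → ℝ} (hu : Integrable u) (hη : Integrable η)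
    (hg : Continuous g) {C : ℝ} (hC : ∀ x, |g x| ≤ C) :
    ∫ x, conv u η x * g x = ∫ y, u y * ∫ x, η (x - y) * g x := by
  have hi : Integrable (fun p : RN N × RN N => u p.2 * η (p.1 - p.2) * g p.1)
      (volume.prod volume) :=
    (integrable_conv_integrand hu hη).mul_bdd (c := C)
      (hg.comp continuous_fst).aestronglyMeasurable (Eventually.of_forall fun _ => hC _)
  calc _ = ∫ x, ∫ y, u y * η (x - y) * g x := by
        simp only [conv_apply, integral_mul_const]
    _ = ∫ y, ∫ x, u y * η (x - y) * g x := integral_integral_swap hi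
    _ = _ := by simp only [mul_assoc, integral_const_mul]

/-- The non-local Hessian of a mollified function. -/
theorem integral_conv_mul_nonlocalHess (hN : 1 ≤ N) {ρ : RN N → ℝ} (hρ : IsRadialMollifier ρ)
    {u η φ : RN N → ℝ} (hu : Integrable u) (hη : IsTestFunction η) (hφ : IsTestFunction φ)
    (i j : Fin N) : ∫ x, conv u η x * nonlocalHess ρ i j φ x =
      ∫ x, conv u (nonlocalHess ρ i j η) x * φ x := by
  obtain ⟨C, hC⟩ := exists_nonlocalHess_le hN hρ hφ i j
  obtain ⟨D, hD⟩ := hφ.exists_abs_le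
  rw [integral_conv_mul hu hη.integrable (continuous_nonlocalHess hρ hφ i j) hC,
    integral_conv_mul hu (integrable_nonlocalHess hN hρ hη i j) hφ.continuous hD]
  congr 1
  ext y
  -- Self-adjointness moves the operator onto the translate `η(· - y)`; translation covariance then
  -- exhibits the translate of the non-local Hessian of `η`.
  rw [integral_mul_nonlocalHess hρ hφ (hη.comp_sub_const y)]
  simp only [nonlocalHess_comp_sub_const]

/-! ### Energies of mollified functions -/

theorem norm_mat_le_sum (A : Mat N) : ‖A‖ ≤ ∑ p, ‖A p‖ := by
  have e : A = ∑ p, A p • EuclideanSpace.single p (1 : ℝ) := by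
    ext m
    simp [Finset.sum_apply, Pi.single_apply]
  conv_lhs => rw [e]
  refine (norm_sum_le _ _).trans (Finset.sum_le_sum fun p _ => ?_)
  simp [norm_smul]

theorem enorm_mat_le_sum (A : Mat N) : ‖A‖ₑ ≤ ∑ p, ‖A p‖ₑ := by
  simp only [← ofReal_norm]
  rw [← ENNReal.ofReal_sum_of_nonneg fun p _ => norm_nonneg _]
  exact ENNReal.ofReal_le_ofReal (norm_mat_le_sum A)

/-- The classical Hessian of the mollification of `u` by `η`. -/
def hessConv (u η : RN N → ℝ) (x : RN N) : Mat N :=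
  WithLp.toLp 2 fun p => conv u (partialDeriv p.1 (partialDeriv p.2 η)) x

/-- The non-local Hessian of the mollification of `u` by `η`. -/
def nonlocalHessConv (ρ : RN N → ℝ) (u η : RN N → ℝ) (x : RN N) : Mat N :=
  WithLp.toLp 2 fun p => conv u (nonlocalHess ρ p.1 p.2 η) x

/-- Equality almost everywhere suffices, so that it applies to the representative chosen by an `Lp`
class. -/
theorem isNonlocalHessianFunction_conv (hN : 1 ≤ N) {ρ : RN N → ℝ} (hρ : IsRadialMollifier ρ)
    {u v η : RN N → ℝ} (hu : Integrable u) (hη : IsTestFunction η) (hv : v =ᵐ[volume] conv u η) :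
    IsNonlocalHessianFunction ρ v (nonlocalHessConv ρ u η) where
  locallyIntegrable := by
    refine Integrable.locallyIntegrable (Integrable.of_eval_piLp fun p => ?_)
    exact integrable_conv hu (integrable_nonlocalHess hN hρ hη p.1 p.2)
  pairing φ hφ i j := by
    rw [distNonlocalHess]
    simp only [nonlocalHessConv]
    rw [← integral_conv_mul_nonlocalHess hN hρ hu hη hφ]
    refine integral_congr_ae ?_
    filter_upwards [hv] with x hx
    rw [hx]

/-- The density `u * Hη` differs from `u * D²η` by `u` convolved with the consistency error; Young's
inequality bounds each of the `N²` entries. The constant depends on `u` and `η`, not on `ρ`. -/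
theorem exists_nonlocalEnergy_conv_le (hN : 1 ≤ N) {u η : RN N → ℝ} (hu : Integrable u)
    (hη : IsTestFunction η) : ∃ C : ℝ, 0 ≤ C ∧ ∀ ρ : RN N → ℝ, IsRadialMollifier ρ →
      ∀ v : RN N → ℝ, v =ᵐ[volume] conv u η →
        nonlocalEnergy ρ v ≤ (∫⁻ x, ‖hessConv u η x‖ₑ) + ENNReal.ofReal (C * truncMoment ρ) := by
  obtain ⟨C, hC0, hC⟩ := exists_lintegral_nonlocalHess_sub_le hN hη
  set a := ∫ x, ‖u x‖
  have ha0 : 0 ≤ a := integral_nonneg fun _ => norm_nonneg _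
  have ha : ∫⁻ x, ‖u x‖ₑ = ENNReal.ofReal a := (ofReal_integral_norm_eq_lintegral_enorm hu).symm
  refine ⟨(N * N : ℕ) * (a * C), by positivity, fun ρ hρ v hv => ?_⟩
  have hd : ∀ p : Fin N × Fin N, IsTestFunction (partialDeriv p.1 (partialDeriv p.2 η)) :=
    fun p => (hη.partialDeriv p.2).partialDeriv p.1
  set r : Fin N × Fin N → RN N → ℝ := fun p x =>
    nonlocalHess ρ p.1 p.2 η x - partialDeriv p.1 (partialDeriv p.2 η) x
  have hr : ∀ p, Integrable (r p) := fun p =>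
    (integrable_nonlocalHess hN hρ hη p.1 p.2).sub (hd p).integrable
  refine (iInf₂_le _ (isNonlocalHessianFunction_conv hN hρ hu hη hv)).trans ?_
  have hm : ∀ p, AEMeasurable (fun x => ‖conv u (r p) x‖ₑ) := fun p =>
    (integrable_conv hu (hr p)).aestronglyMeasurable.enorm
  calc _ ≤ ∫⁻ x, (‖hessConv u η x‖ₑ + ∑ p, ‖conv u (r p) x‖ₑ) := by
        refine lintegral_mono fun x => ?_
        have e : nonlocalHessConv ρ u η x =
            hessConv u η x + (nonlocalHessConv ρ u η x - hessConv u η x) := by abel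
        rw [e]
        refine (enorm_add_le _ _).trans (add_le_add_right ((enorm_mat_le_sum _).trans ?_) _)
        refine Finset.sum_le_sum fun p _ => le_of_eq ?_
        congr 1
        obtain ⟨D, hD⟩ := exists_nonlocalHess_le hN hρ hη p.1 p.2
        exact conv_sub_right x (integrable_mul_comp_sub hu (continuous_nonlocalHess hρ hη _ _) hD x)
          ((hd p).integrable_mul_comp_sub hu x)
    _ = (∫⁻ x, ‖hessConv u η x‖ₑ) + ∑ p, ∫⁻ x, ‖conv u (r p) x‖ₑ := by
        rw [lintegral_add_right' _ (Finset.aemeasurable_fun_sum _ fun p _ => hm p),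
          lintegral_finsetSum' _ fun p _ => hm p]
    _ ≤ (∫⁻ x, ‖hessConv u η x‖ₑ) +
          ∑ p : Fin N × Fin N, ENNReal.ofReal a * ENNReal.ofReal (C * truncMoment ρ) := by
        gcongr with p
        refine (lintegral_enorm_conv_le hu (hr p)).trans ?_
        rw [ha]
        gcongr
        exact hC ρ hρ p.1 p.2
    _ = _ := by
        rw [Finset.sum_const, nsmul_eq_mul, mul_assoc, mul_assoc,
          ENNReal.ofReal_mul (p := ((N * N : ℕ) : ℝ)) (by positivity), ENNReal.ofReal_mul ha0]
        simp

/-! ### Distributional Hessians that are measures -/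

/-- The second distributional derivative of `u` is the measure `μ`. -/
def IsDistHessian (u : RN N → ℝ) (μ : VectorMeasure (RN N) (Mat N)) : Prop :=
  ∀ φ : RN N → ℝ, IsTestFunction φ → ∀ i j : Fin N,
    ∫ x, u x * partialDeriv i (partialDeriv j φ) x = (∫ᵛ x, φ x ∂•μ) (i, j)

theorem IsHessianMeasure.isDistHessian {u : RN N → ℝ} {μ : VectorMeasure (RN N) (Mat N)}
    (h : IsHessianMeasure u μ) : IsDistHessian u μ := by
  obtain ⟨-, g, -, hg, hμ⟩ := h
  intro φ hφ i j
  rw [hg _ (hφ.partialDeriv j), hμ.pairing φ hφ, neg_neg]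

theorem partialDeriv_comp_const_sub {φ : RN N → ℝ} (hφ : IsTestFunction φ) (i : Fin N)
    (x y : RN N) : partialDeriv i (fun z => φ (x - z)) y = - partialDeriv i φ (x - y) := by
  have := (hφ.hasFDerivAt (x - y)).comp y ((hasFDerivAt_id y).const_sub x)
  rw [partialDeriv, show (fun z => φ (x - z)) = φ ∘ fun z => x - z from rfl, this.fderiv]
  simp [partialDeriv]

/-- Test the distribution with `η(x - ·)`; the two signs from the chain rule cancel. -/
theorem IsDistHessian.hessConv_eq {u : RN N → ℝ} {μ : VectorMeasure (RN N) (Mat N)}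
    (h : IsDistHessian u μ) {η : RN N → ℝ} (hη : IsTestFunction η) (x : RN N) :
    hessConv u η x = ∫ᵛ y, η (x - y) ∂•μ := by
  ext p
  have h1 := h _ (hη.comp_const_sub x) p.1 p.2
  rw [← h1, hessConv]
  simp only [conv_apply]
  congr 1
  ext y
  have e : partialDeriv p.2 (fun z => η (x - z)) = fun z => - partialDeriv p.2 η (x - z) :=
    funext fun z => partialDeriv_comp_const_sub hη _ _ _
  have e2 : partialDeriv p.1 (fun z => - partialDeriv p.2 η (x - z)) y =
      - partialDeriv p.1 (fun z => partialDeriv p.2 η (x - z)) y := by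
    simp [partialDeriv, fderiv_fun_neg]
  rw [e, e2, partialDeriv_comp_const_sub (hη.partialDeriv _), neg_neg]

/-- Young's inequality for a function and a measure: bound the integral by the variation, then apply
Tonelli and translation invariance. -/
theorem IsDistHessian.lintegral_hessConv_le {u : RN N → ℝ} {μ : VectorMeasure (RN N) (Mat N)}
    (h : IsDistHessian u μ) (hμ : μ.variation Set.univ < ⊤) {η : RN N → ℝ}
    (hη : IsTestFunction η) :
    ∫⁻ x, ‖hessConv u η x‖ₑ ≤ (∫⁻ x, ‖η x‖ₑ) * μ.variation Set.univ := by
  have : IsFiniteMeasure μ.variation := ⟨hμ⟩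
  have hm : Measurable fun p : RN N × RN N => ‖η (p.1 - p.2)‖ₑ :=
    (hη.continuous.comp (continuous_fst.sub continuous_snd)).measurable.enorm
  calc _ ≤ ∫⁻ x, ∫⁻ y, ‖η (x - y)‖ₑ ∂μ.variation := by
        refine lintegral_mono fun x => ?_
        rw [h.hessConv_eq hη]
        refine VectorMeasure.enorm_integral_le_lintegral_enorm.trans ?_
        refine (mul_le_mul' ?_ le_rfl).trans (one_mul _).le
        rw [← ofReal_norm]
        exact ENNReal.ofReal_le_one.2 ContinuousLinearMap.opNorm_lsmul_le
    _ = ∫⁻ y, ∫⁻ x, ‖η (x - y)‖ₑ ∂volume ∂μ.variation := lintegral_lintegral_swap hm.aemeasurable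
    _ = _ := by
        simp only [lintegral_sub_right_eq_self (fun x => ‖η x‖ₑ)]
        rw [lintegral_const]

/-! ### Approximation in `L¹` -/

theorem tendsto_lintegral_translate {u : RN N → ℝ} (hu : Integrable u) :
    Tendsto (fun y : RN N => ∫⁻ x, ‖u (x - y) - u x‖ₑ) (𝓝 0) (𝓝 0) := by
  set f : Lp ℝ 1 (volume : Measure (RN N)) := hu.toL1 u
  have hf : ⇑f =ᵐ[volume] u := hu.coeFn_toL1
  set g : RN N → C(RN N, RN N) := fun y => ⟨fun x => x - y, continuous_id.sub continuous_const⟩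
  have hg : Continuous g := ContinuousMap.continuous_of_continuous_uncurry _
    (continuous_snd.sub continuous_fst)
  have hgm : ∀ y, MeasurePreserving (g y) (volume : Measure (RN N)) volume := fun y =>
    measurePreserving_sub_right volume y
  have h1 : Tendsto (fun y => Lp.compMeasurePreserving (g y) (hgm y) f) (𝓝 0)
      (𝓝 (Lp.compMeasurePreserving (g 0) (hgm 0) f)) :=
    tendsto_const_nhds.compMeasurePreservingLp (hg.tendsto 0) hgm (hgm 0) ENNReal.one_ne_top
  have h2 := tendsto_iff_edist_tendsto_0.1 h1
  refine h2.congr fun y => ?_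
  rw [Lp.edist_def, eLpNorm_one_eq_lintegral_enorm]
  refine lintegral_congr_ae ?_
  have e1 : ∀ y, ⇑(Lp.compMeasurePreserving (g y) (hgm y) f) =ᵐ[volume] fun x => u (x - y) :=
    fun y => (Lp.coeFn_compMeasurePreserving f (hgm y)).trans
      ((hgm y).quasiMeasurePreserving.ae_eq_comp hf)
  filter_upwards [e1 y, e1 0] with x hx hx0
  rw [Pi.sub_apply, hx, hx0, sub_zero]

/-- Since `∫ η = 1`, the difference is an average of `u(· - y) - u` weighted by `η`, and only `y`
with `η y ≠ 0` count. -/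
theorem lintegral_conv_sub_le {u η : RN N → ℝ} (hu : Integrable u) (hη : IsTestFunction η)
    (h1 : ∫ x, η x = 1) (h1' : ∫⁻ x, ‖η x‖ₑ = 1) {ε : ENNReal}
    (hε : ∀ y, η y ≠ 0 → ∫⁻ x, ‖u (x - y) - u x‖ₑ ≤ ε) :
    ∫⁻ x, ‖conv u η x - u x‖ₑ ≤ ε := by
  have hm : AEStronglyMeasurable (fun p : RN N × RN N => (u (p.1 - p.2) - u p.1) * η p.2)
      (volume.prod volume) := by
    refine AEStronglyMeasurable.mul (AEStronglyMeasurable.sub ?_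
      hu.aestronglyMeasurable.comp_fst) hη.continuous.aestronglyMeasurable.comp_snd
    exact hu.aestronglyMeasurable.comp_quasiMeasurePreserving
      (quasiMeasurePreserving_sub_of_right_invariant volume volume)
  calc _ = ∫⁻ x, ‖∫ y, (u (x - y) - u x) * η y‖ₑ := by
        refine lintegral_congr fun x => ?_
        have hi : Integrable fun y => u (x - y) * η y := by
          simpa using (hη.integrable_mul_comp_sub hu x).comp_sub_left x
        congr 1
        have e : conv u η x = ∫ y, u (x - y) * η y := by
          rw [conv_apply, ← integral_sub_left_eq_self _ _ x]
          simp
        simp only [sub_mul]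
        rw [integral_sub hi (hη.integrable.const_mul _), integral_const_mul, h1, mul_one, e]
    _ ≤ ∫⁻ x, ∫⁻ y, ‖(u (x - y) - u x) * η y‖ₑ :=
        lintegral_mono fun x => enorm_integral_le_lintegral_enorm _
    _ = ∫⁻ y, ∫⁻ x, ‖(u (x - y) - u x) * η y‖ₑ := lintegral_lintegral_swap hm.enorm
    _ ≤ ∫⁻ y, ε * ‖η y‖ₑ := by
        refine lintegral_mono fun y => ?_
        simp only [enorm_mul]
        rw [lintegral_mul_const' _ _ (by simp)]
        by_cases hy : η y = 0
        · simp [hy]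
        · gcongr
          exact hε y hy
    _ = ε := by
        rw [lintegral_const_mul _ hη.continuous.measurable.enorm, h1', mul_one]

/-- A smooth approximate identity for the convolution in `L¹`. -/
structure IsApproxIdentity (η : ℕ → RN N → ℝ) : Prop where
  isTestFunction : ∀ k, IsTestFunction (η k)
  lintegral_enorm : ∀ k, ∫⁻ x, ‖η k x‖ₑ = 1
  tendsto : ∀ u : RN N → ℝ, Integrable u →
    Tendsto (fun k => ∫⁻ x, ‖conv u (η k) x - u x‖ₑ) atTop (𝓝 0)

theorem exists_isApproxIdentity (N : ℕ) : ∃ η : ℕ → RN N → ℝ, IsApproxIdentity η := by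
  set f : ℕ → ContDiffBump (0 : RN N) := fun k =>
    ⟨1 / (k + 1) / 2, 1 / (k + 1), by positivity, half_lt_self (by positivity)⟩
  have hint : ∀ k, ∫ x, (f k).normed volume x = 1 := fun k => (f k).integral_normed
  have ht : ∀ k, IsTestFunction ((f k).normed volume) := fun k =>
    ⟨(f k).contDiff_normed, (f k).hasCompactSupport_normed⟩
  have hl : ∀ k, ∫⁻ x, ‖(f k).normed volume x‖ₑ = 1 := fun k => by
    rw [← ofReal_integral_norm_eq_lintegral_enorm (ht k).integrable]
    simp only [Real.norm_of_nonneg ((f k).nonneg_normed _), hint, ENNReal.ofReal_one]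
  refine ⟨fun k => (f k).normed volume, ht, hl, fun u hu => ?_⟩
  rw [ENNReal.tendsto_nhds_zero]
  intro ε hε
  obtain ⟨δ, hδ, h⟩ := Metric.eventually_nhds_iff.1
    (ENNReal.tendsto_nhds_zero.1 (tendsto_lintegral_translate hu) ε hε)
  filter_upwards [tendsto_one_div_add_atTop_nhds_zero_nat.eventually (gt_mem_nhds hδ)] with k hk
  refine lintegral_conv_sub_le hu (ht k) (hint k) (hl k) fun y hy => h ?_
  have : y ∈ Metric.ball (0 : RN N) (1 / (k + 1)) := by
    rw [← (f k).support_normed_eq (μ := volume)]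
    exact hy
  exact (Metric.mem_ball.1 this).trans hk

/-! ### The recovery sequence -/

/-- Take for `κ n` the largest `k ≤ n` with `|a k n| ≤ 1/(k+1)`. Each fixed `K` eventually
qualifies, so `κ` tends to infinity. -/
theorem exists_diagonal {a : ℕ → ℕ → ℝ} (ha : ∀ k, Tendsto (a k) atTop (𝓝 0)) :
    ∃ κ : ℕ → ℕ, Tendsto κ atTop atTop ∧ Tendsto (fun n => a (κ n) n) atTop (𝓝 0) := by
  classical
  set P : ℕ → ℕ → Prop := fun n k => |a k n| ≤ 1 / ((k : ℝ) + 1)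
  set κ : ℕ → ℕ := fun n => Nat.findGreatest (P n) n
  have hκ : Tendsto κ atTop atTop := by
    refine tendsto_atTop.2 fun K => ?_
    have h1 : ∀ᶠ n in atTop, |a K n - 0| < 1 / ((K : ℝ) + 1) :=
      Metric.tendsto_nhds.1 (ha K) _ (by positivity)
    filter_upwards [h1, eventually_ge_atTop K] with n hn hK
    exact Nat.le_findGreatest hK (by simpa [P] using hn.le)
  refine ⟨κ, hκ, ?_⟩
  have h2 : Tendsto (fun n => 1 / ((κ n : ℝ) + 1)) atTop (𝓝 0) :=
    tendsto_one_div_add_atTop_nhds_zero_nat.comp hκ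
  refine squeeze_zero_norm' ?_ h2
  -- `Nat.findGreatest` returns `0` by default, so the property is guaranteed only where `κ n ≥ 1`.
  filter_upwards [hκ.eventually (eventually_ge_atTop 1)] with n hn
  exact Nat.findGreatest_of_ne_zero (P := P n) rfl (by omega)

theorem exists_recovery_sequence (hN : 1 ≤ N) {ρ : ℕ → RN N → ℝ} (hρ : IsRadialMollifierSeq ρ)
    (u : Lp ℝ 1 (volume : Measure (RN N))) :
    ∃ y : ℕ → Lp ℝ 1 (volume : Measure (RN N)), Tendsto y atTop (𝓝 u) ∧
      limsup (fun n => nonlocalEnergy (ρ n) (y n)) atTop ≤ hessianVariation u := by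
  obtain ⟨η, hη⟩ := exists_isApproxIdentity N
  have hu : Integrable u := L1.integrable_coeFn u
  have hc : ∀ k, Integrable (conv u (η k)) := fun k =>
    integrable_conv hu (hη.isTestFunction k).integrable
  set v : ℕ → Lp ℝ 1 (volume : Measure (RN N)) := fun k => (hc k).toL1 _
  have hv : ∀ k, ⇑(v k) =ᵐ[volume] conv u (η k) := fun k => (hc k).coeFn_toL1
  have hvu : Tendsto v atTop (𝓝 u) := by
    rw [tendsto_iff_edist_tendsto_0]
    refine (hη.tendsto u hu).congr fun k => ?_
    rw [Lp.edist_def, eLpNorm_one_eq_lintegral_enorm]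
    refine lintegral_congr_ae ?_
    filter_upwards [hv k] with x hx
    simp [hx]
  choose C hC0 hC using fun k => exists_nonlocalEnergy_conv_le hN hu (hη.isTestFunction k)
  -- If `u` has no Hessian measure, the right side is an infimum over the empty family and the bound
  -- is trivial.
  have hF : ∀ k, ∫⁻ x, ‖hessConv u (η k) x‖ₑ ≤ hessianVariation u := fun k => by
    refine le_iInf₂ fun μ hμ => ?_
    have hfin : μ.variation Set.univ < ⊤ := by
      obtain ⟨-, g, -, -, hg⟩ := id hμ
      exact hg.finite
    simpa [hη.lintegral_enorm k] using
      hμ.isDistHessian.lintegral_hessConv_le hfin (hη.isTestFunction k)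
  obtain ⟨κ, hκ, hκ0⟩ := exists_diagonal (a := fun k n => C k * truncMoment (ρ n)) fun k => by
    simpa using hρ.tendsto_truncMoment.const_mul (C k)
  refine ⟨fun n => v (κ n), hvu.comp hκ, ?_⟩
  have hlim : Tendsto (fun n => hessianVariation u +
      ENNReal.ofReal (C (κ n) * truncMoment (ρ n))) atTop (𝓝 (hessianVariation u)) := by
    have := (ENNReal.tendsto_ofReal hκ0).const_add (hessianVariation u)
    simpa using this
  calc _ ≤ limsup (fun n => hessianVariation u +
        ENNReal.ofReal (C (κ n) * truncMoment (ρ n))) atTop := by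
        refine limsup_le_limsup (Eventually.of_forall fun n => ?_)
        exact (hC (κ n) (ρ n) (hρ.isRadialMollifier n) _ (hv _)).trans
          (add_le_add_left (hF _) _)
    _ = _ := hlim.limsup_eq

/-! ### Weak limits of bounded sequences of densities -/

/-- Limits along an ultrafilter exist for all test functions at once, which replaces extracting a
weakly convergent subsequence. -/
theorem exists_tendsto_ultrafilter (𝓤 : Ultrafilter ℕ) {a : ℕ → ℝ} {B : ℝ}
    (ha : ∀ n, |a n| ≤ B) : ∃ x, Tendsto a 𝓤 (𝓝 x) := by
  obtain ⟨x, -, hx⟩ := (isCompact_Icc (a := -B) (b := B)).ultrafilter_le_nhds' (𝓤.map a)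
    (Filter.mem_map.2 (Filter.univ_mem' fun n => abs_le.1 (ha n)))
  exact ⟨x, hx⟩

theorem abs_integral_mul_le {f w : RN N → ℝ} (hw0 : ∀ x, 0 ≤ w x) (hw : Integrable w) {B : ℝ}
    (hB : ∫ x, w x ≤ B) {C : ℝ} (hC0 : 0 ≤ C) (hC : ∀ x, |f x| ≤ C) :
    |∫ x, f x * w x| ≤ C * B := by
  calc |∫ x, f x * w x| ≤ ∫ x, C * w x := by
        rw [← Real.norm_eq_abs]
        refine norm_integral_le_of_norm_le (hw.const_mul C) (Eventually.of_forall fun x => ?_)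
        rw [norm_mul, Real.norm_of_nonneg (hw0 x)]
        exact mul_le_mul_of_nonneg_right (hC x) (hw0 x)
    _ ≤ C * B := by
        rw [integral_const_mul]
        exact mul_le_mul_of_nonneg_left hB hC0

/-- A bounded sequence of nonnegative densities has a weak limit along an ultrafilter. -/
theorem exists_weak_limit (𝓤 : Ultrafilter ℕ) {w : ℕ → RN N → ℝ} (hw0 : ∀ n x, 0 ≤ w n x)
    (hw : ∀ n, Integrable (w n)) {B : ℝ} (hB : ∀ n, ∫ x, w n x ≤ B) :
    ∃ ν : Measure (RN N), ν Set.univ ≤ ENNReal.ofReal B ∧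
      ∀ f : RN N → ℝ, Continuous f → HasCompactSupport f →
        Tendsto (fun n => ∫ x, f x * w n x) 𝓤 (𝓝 (∫ x, f x ∂ν)) := by
  have hbd : ∀ f : CompactlySupportedContinuousMap (RN N) ℝ, ∃ C, 0 ≤ C ∧ ∀ x, |f x| ≤ C :=
    fun f => by
    obtain ⟨C, hC⟩ := f.hasCompactSupport.exists_bound_of_continuous f.continuous
    exact ⟨C, (norm_nonneg _).trans (hC 0), hC⟩
  have hi : ∀ (f : CompactlySupportedContinuousMap (RN N) ℝ) n,
      Integrable fun x => f x * w n x := fun f n => by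
    obtain ⟨C, -, hC⟩ := hbd f
    exact (hw n).bdd_mul f.continuous.aestronglyMeasurable (Eventually.of_forall hC)
  have hex : ∀ f : CompactlySupportedContinuousMap (RN N) ℝ,
      ∃ y, Tendsto (fun n => ∫ x, f x * w n x) 𝓤 (𝓝 y) := fun f => by
    obtain ⟨C, hC0, hC⟩ := hbd f
    exact exists_tendsto_ultrafilter 𝓤 fun n => abs_integral_mul_le (hw0 n) (hw n) (hB n) hC0 hC
  choose T hT using hex
  -- The limit functional is linear and positive, so the Riesz–Markov–Kakutani theorem represents it
  -- by a measure.
  set Λ₀ : CompactlySupportedContinuousMap (RN N) ℝ →ₗ[ℝ] ℝ :=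
    { toFun := T
      map_add' := fun f g => by
        refine tendsto_nhds_unique (hT (f + g)) (((hT f).add (hT g)).congr fun n => ?_)
        rw [← integral_add (hi f n) (hi g n)]
        simp [add_mul]
      map_smul' := fun c f => by
        refine tendsto_nhds_unique (hT (c • f)) (((hT f).const_mul c).congr fun n => ?_)
        rw [← integral_const_mul]
        simp [mul_assoc] }
  set Λ : CompactlySupportedContinuousMap (RN N) ℝ →ₚ[ℝ] ℝ :=
    PositiveLinearMap.mk₀ Λ₀ fun f hf => ge_of_tendsto' (hT f) fun n =>
      integral_nonneg fun x => mul_nonneg (hf x) (hw0 n x)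
  refine ⟨RealRMK.rieszMeasure Λ, ?_, fun f hf hfc => ?_⟩
  -- Total mass is bounded through compact sets: a cut-off equal to one on `K` with values in
  -- `[0,1]` integrates to at most `B` against every density.
  · rw [isOpen_univ.measure_eq_iSup_isCompact]
    refine iSup₂_le fun K _ => iSup_le fun hK => ?_
    obtain ⟨f, hf1, hfc, -, hf01⟩ :=
      exists_continuousMap_one_of_isCompact_subset_isOpen hK isOpen_univ (Set.subset_univ K)
    refine (RealRMK.rieszMeasure_le_of_eq_one Λ (f := ⟨f, hfc⟩) (fun x => (hf01 x).1) hK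
      fun x hx => hf1 hx).trans (ENNReal.ofReal_le_ofReal ?_)
    refine le_of_tendsto' (hT _) fun n => ?_
    refine le_trans (le_abs_self _) ?_
    have := abs_integral_mul_le (f := f) (hw0 n) (hw n) (hB n) zero_le_one
      fun x => by rw [abs_of_nonneg (hf01 x).1]; exact (hf01 x).2
    rwa [one_mul] at this
  · have h1 := hT ⟨⟨f, hf⟩, hfc⟩
    have h2 := RealRMK.integral_rieszMeasure Λ ⟨⟨f, hf⟩, hfc⟩
    change Tendsto (fun n => ∫ x, f x * w n x) 𝓤 (𝓝 (Λ ⟨⟨f, hf⟩, hfc⟩)) at h1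
    rw [← h2] at h1
    exact h1

/-! ### Integrals against images of vector measures -/

/-- Both sides extend the same additive set function; only the dominating measures differ, and the
variation of the image is at most `‖c‖` times that of `μ`. It serves to compute entries of
matrix-valued integrals. -/
theorem continuousLinearMap_vectorIntegral {X E F : Type*} [MeasurableSpace X]
    [NormedAddCommGroup E] [NormedSpace ℝ E] [CompleteSpace E]
    [NormedAddCommGroup F] [NormedSpace ℝ F] [CompleteSpace F]
    (μ : VectorMeasure X E) (c : E →L[ℝ] F) {f : X → ℝ} (hf : Integrable f μ.variation) :
    c (∫ᵛ x, f x ∂•μ) =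
      ∫ᵛ x, f x ∂•(μ.mapRange c.toLinearMap.toAddMonoidHom c.continuous) := by
  rw [VectorMeasure.continuousLinearMap_apply_integral hf, VectorMeasure.integral_eq_setToFun,
    VectorMeasure.integral_eq_setToFun]
  have hle : (μ.mapRange c.toLinearMap.toAddMonoidHom c.continuous).variation ≤
      (‖c‖₊ : ENNReal) • μ.variation := by
    refine VectorMeasure.variation_le_of_forall_enorm_le fun s _ => ?_
    refine (c.le_opENorm (μ s)).trans ?_
    rw [Measure.smul_apply, smul_eq_mul]
    exact mul_le_mul' le_rfl (VectorMeasure.enorm_measure_le_variation μ s)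
  have e : (μ.transpose ((ContinuousLinearMap.compL ℝ E E F c) ∘L ContinuousLinearMap.lsmul ℝ ℝ) :
      Set X → ℝ →L[ℝ] F) = (μ.mapRange c.toLinearMap.toAddMonoidHom c.continuous).transpose
        (ContinuousLinearMap.lsmul ℝ ℝ) := by
    refine funext fun s => ContinuousLinearMap.ext fun x => ?_
    change c (x • μ s) = x • c (μ s)
    exact c.map_smul x _
  have hT := dominatedFinMeasAdditive_cbmApplyMeasure μ
    ((ContinuousLinearMap.compL ℝ E E F c) ∘L ContinuousLinearMap.lsmul ℝ ℝ)
  rw [setToFun_congr_left _ (e ▸ hT) e]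
  exact setToFun_congr_measure_of_integrable _ ENNReal.coe_ne_top hle _ _ _ hf

/-- The matrix-valued measure with given entries. -/
def matMeasure (σ : Fin N × Fin N → SignedMeasure (RN N)) : VectorMeasure (RN N) (Mat N) where
  measureOf' s := WithLp.toLp 2 fun p => σ p s
  empty' := by ext; simp
  not_measurable' s hs := by ext; simp [VectorMeasure.not_measurable _ hs]
  m_iUnion' f hf hd := by
    have h : HasSum (fun n => fun p => σ p (f n)) (fun p => σ p (⋃ n, f n)) :=
      Pi.hasSum.2 fun p => (σ p).m_iUnion hf hd
    exact h.mapL ((PiLp.continuousLinearEquiv 2 ℝ fun _ : Fin N × Fin N => ℝ).symm :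
      (Fin N × Fin N → ℝ) →L[ℝ] Mat N)

theorem matMeasure_apply (σ : Fin N × Fin N → SignedMeasure (RN N)) (s : Set (RN N))
    (p : Fin N × Fin N) : matMeasure σ s p = σ p s := rfl

theorem signed_integral_sub {ν₁ ν₂ : Measure (RN N)} [IsFiniteMeasure ν₁] [IsFiniteMeasure ν₂]
    {f : RN N → ℝ} (h1 : Integrable f ν₁) (h2 : Integrable f ν₂) :
    ∫ᵛ x, f x ∂•(ν₁.toSignedMeasure - ν₂.toSignedMeasure) = ∫ x, f x ∂ν₁ - ∫ x, f x ∂ν₂ := by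
  have e : (ContinuousLinearMap.lsmul ℝ ℝ : ℝ →L[ℝ] ℝ →L[ℝ] ℝ).flip =
      ContinuousLinearMap.lsmul ℝ ℝ := by
    ext; simp
  have h : ∀ ν : Measure (RN N), [IsFiniteMeasure ν] →
      ∫ᵛ x, f x ∂•ν.toSignedMeasure = ∫ x, f x ∂ν := fun ν _ => by
    rw [← VectorMeasure.integral_toSignedMeasure, e]
  rw [VectorMeasure.integral_sub_vectorMeasure, h, h]
  · simpa [VectorMeasure.Integrable] using h1
  · simpa [VectorMeasure.Integrable] using h2

theorem _root_.Continuous.integrable_of_isFiniteMeasure_of_hasCompactSupport {f : RN N → ℝ}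
    (hf : Continuous f) (hc : HasCompactSupport f) (ν : Measure (RN N)) [IsFiniteMeasure ν] :
    Integrable f ν := by
  obtain ⟨C, hC⟩ := hc.exists_bound_of_continuous hf
  exact Integrable.of_bound hf.aestronglyMeasurable C (Eventually.of_forall hC)

/-- A sequence of matrix fields that is bounded in `L¹` converges weakly, along an ultrafilter, to
a measure whose variation does not exceed the bound. -/
theorem exists_weak_limit_mat (𝓤 : Ultrafilter ℕ) {G : ℕ → RN N → Mat N}
    (hG : ∀ n, Integrable (G n)) {B : ℝ} (hB : ∀ n, ∫ x, ‖G n x‖ ≤ B) :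
    ∃ μ : VectorMeasure (RN N) (Mat N), μ.variation Set.univ ≤ ENNReal.ofReal B ∧
      ∀ f : RN N → ℝ, Continuous f → HasCompactSupport f → ∀ p,
        Tendsto (fun n => ∫ x, f x * G n x p) 𝓤 (𝓝 ((∫ᵛ x, f x ∂•μ) p)) := by
  have hGp : ∀ n p, Integrable fun x => G n x p := fun n p => (hG n).eval_piLp p
  have hle : ∀ n p x, |G n x p| ≤ ‖G n x‖ := fun n p x => by
    simpa using PiLp.norm_apply_le (G n x) p
  obtain ⟨ν, hν, hνt⟩ := exists_weak_limit 𝓤 (w := fun n x => ‖G n x‖)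
    (fun _ _ => norm_nonneg _) (fun n => (hG n).norm) hB
  -- The entries have no sign, so the nonnegative densities `‖G n‖ + (G n)_p` are used and the limit
  -- of `‖G n‖` is subtracted afterwards.
  have hex : ∀ p, ∃ ν : Measure (RN N), ν Set.univ ≤ ENNReal.ofReal (2 * B) ∧
      ∀ f : RN N → ℝ, Continuous f → HasCompactSupport f →
        Tendsto (fun n => ∫ x, f x * (‖G n x‖ + G n x p)) 𝓤 (𝓝 (∫ x, f x ∂ν)) := fun p => by
    refine exists_weak_limit 𝓤 (w := fun n x => ‖G n x‖ + G n x p) (fun n x => ?_)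
      (fun n => (hG n).norm.add (hGp n p)) fun n => ?_
    · linarith [neg_abs_le (G n x p), hle n p x]
    · refine le_trans (integral_mono ((hG n).norm.add (hGp n p)) ((hG n).norm.const_mul 2)
        fun x => ?_) ?_
      · simp only
        linarith [le_abs_self (G n x p), hle n p x]
      · rw [integral_const_mul]
        linarith [hB n]
  choose νp hνp hνpt using hex
  have : IsFiniteMeasure ν := ⟨hν.trans_lt ENNReal.ofReal_lt_top⟩
  have : ∀ p, IsFiniteMeasure (νp p) := fun p => ⟨(hνp p).trans_lt ENNReal.ofReal_lt_top⟩
  set μ : VectorMeasure (RN N) (Mat N) :=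
    matMeasure fun p => (νp p).toSignedMeasure - ν.toSignedMeasure
  -- A crude finite measure dominating both `μ.variation` and `ν`. The sharp bound by `ν` alone
  -- comes at the end.
  set m : Measure (RN N) := ν + ∑ p, (νp p + ν)
  have hμm : μ.variation ≤ m := by
    refine VectorMeasure.variation_le_of_forall_enorm_le fun E hE => ?_
    refine (enorm_mat_le_sum _).trans ?_
    rw [Measure.add_apply, Measure.finsetSum_apply]
    refine le_trans (Finset.sum_le_sum fun p _ => ?_) le_add_self
    rw [matMeasure_apply, sub_apply, Measure.add_apply]
    refine enorm_sub_le.trans (add_le_add ?_ ?_)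
    · simpa using VectorMeasure.enorm_measure_le_variation (νp p).toSignedMeasure E
    · simpa using VectorMeasure.enorm_measure_le_variation ν.toSignedMeasure E
  have hνm : ν ≤ m := Measure.le_add_right le_rfl
  have : IsFiniteMeasure μ.variation := isFiniteMeasure_of_le m hμm
  have hint : ∀ f : RN N → ℝ, Continuous f → HasCompactSupport f → ∀ p,
      (∫ᵛ x, f x ∂•μ) p = ∫ x, f x ∂(νp p) - ∫ x, f x ∂ν := fun f hf hc p => by
    have hmr : μ.mapRange (EuclideanSpace.proj (𝕜 := ℝ) p).toLinearMap.toAddMonoidHom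
        (EuclideanSpace.proj (𝕜 := ℝ) p).continuous =
        (νp p).toSignedMeasure - ν.toSignedMeasure := by
      ext s hs
      rfl
    have := continuousLinearMap_vectorIntegral μ (EuclideanSpace.proj (𝕜 := ℝ) p)
      (hf.integrable_of_isFiniteMeasure_of_hasCompactSupport hc _)
    rw [hmr, signed_integral_sub (hf.integrable_of_isFiniteMeasure_of_hasCompactSupport hc _)
      (hf.integrable_of_isFiniteMeasure_of_hasCompactSupport hc _)] at this
    exact this
  have hlim : ∀ f : RN N → ℝ, Continuous f → HasCompactSupport f → ∀ p,
      Tendsto (fun n => ∫ x, f x * G n x p) 𝓤 (𝓝 ((∫ᵛ x, f x ∂•μ) p)) := fun f hf hc p => by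
    obtain ⟨C, hC⟩ := hc.exists_bound_of_continuous hf
    rw [hint f hf hc p]
    refine ((hνpt p f hf hc).sub (hνt f hf hc)).congr fun n => ?_
    have i1 : Integrable fun x => f x * ‖G n x‖ :=
      (hG n).norm.bdd_mul hf.aestronglyMeasurable (Eventually.of_forall hC)
    have i2 : Integrable fun x => f x * G n x p :=
      (hGp n p).bdd_mul hf.aestronglyMeasurable (Eventually.of_forall hC)
    simp only [mul_add]
    rw [integral_add i1 i2]
    ring
  -- Passes to the limit in `‖∫ f G n‖ ≤ ∫ |f| ‖G n‖`. Using the full Frobenius norm here is what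
  -- keeps the final constant equal to one.
  have hnorm : ∀ f : RN N → ℝ, Continuous f → HasCompactSupport f →
      ‖∫ᵛ x, f x ∂•μ‖ ≤ ∫ x, |f x| ∂ν := fun f hf hc => by
    obtain ⟨C, hC⟩ := hc.exists_bound_of_continuous hf
    have hi : ∀ n, Integrable fun x => f x • G n x := fun n =>
      (hG n).bdd_smul C hf.aestronglyMeasurable (Eventually.of_forall hC)
    have h1 : Tendsto (fun n => ∫ x, f x • G n x) 𝓤 (𝓝 (∫ᵛ x, f x ∂•μ)) := by
      have := ((PiLp.continuous_toLp 2 fun _ : Fin N × Fin N => ℝ).tendsto _).comp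
        (tendsto_pi_nhds.2 (hlim f hf hc))
      refine this.congr fun n => ?_
      ext p
      have := (EuclideanSpace.proj (𝕜 := ℝ) p).integral_comp_comm (hi n)
      simpa using this
    refine le_of_tendsto_of_tendsto' h1.norm (hνt _ hf.abs (hc.comp_left abs_zero)) fun n => ?_
    refine (norm_integral_le_integral_norm _).trans_eq ?_
    simp [norm_smul]
  refine ⟨μ, ?_, hlim⟩
  -- It suffices that `‖μ E‖ ≤ ν E`. The indicator of `E` is approximated in `L¹(m)` by a compactly
  -- supported continuous `g`, to which the weak limit inequality applies.
  refine le_trans (Measure.le_iff'.1 (VectorMeasure.variation_le_of_forall_enorm_le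
    (m := ν) fun E hE => ?_) _) hν
  refine ENNReal.le_of_forall_pos_le_add fun ε hε _ => ?_
  have hε2 : (ε / 2 : ENNReal) ≠ 0 := by simpa using hε.ne'
  have hiE : Integrable (E.indicator fun _ => (1 : ℝ)) m :=
    (integrable_const 1).indicator hE
  obtain ⟨g, hgc, hgε, hg, -⟩ := hiE.exists_hasCompactSupport_lintegral_sub_le hε2
  have hgi := hg.integrable_of_isFiniteMeasure_of_hasCompactSupport hgc μ.variation
  have hiE' := hiE.mono_measure hμm
  have e1 : μ E = (∫ᵛ x, g x ∂•μ) + ∫ᵛ x, (E.indicator (fun _ => (1 : ℝ)) x - g x) ∂•μ := by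
    rw [VectorMeasure.integral_fun_sub hiE' hgi, VectorMeasure.integral_indicator_const _ hE]
    simp
  have b1 : ‖∫ᵛ x, g x ∂•μ‖ₑ ≤ ∫⁻ x, ‖g x‖ₑ ∂ν := by
    rw [← ofReal_norm, ← ofReal_integral_norm_eq_lintegral_enorm
      (hg.integrable_of_isFiniteMeasure_of_hasCompactSupport hgc ν)]
    exact ENNReal.ofReal_le_ofReal (hnorm g hg hgc)
  have b2 : ‖∫ᵛ x, (E.indicator (fun _ => (1 : ℝ)) x - g x) ∂•μ‖ₑ ≤ ε / 2 := by
    refine VectorMeasure.enorm_integral_le_lintegral_enorm.trans ?_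
    refine (mul_le_mul' (b := 1) ?_ (lintegral_mono' hμm le_rfl)).trans ?_
    · rw [← ofReal_norm]
      exact ENNReal.ofReal_le_one.2 ContinuousLinearMap.opNorm_lsmul_le
    · rwa [one_mul]
  have b3 : ∫⁻ x, ‖g x‖ₑ ∂ν ≤ ν E + ε / 2 := by
    calc ∫⁻ x, ‖g x‖ₑ ∂ν ≤ ∫⁻ x, (E.indicator (fun _ => 1) x +
          ‖E.indicator (fun _ => (1 : ℝ)) x - g x‖ₑ) ∂ν := by
          refine lintegral_mono fun x => ?_
          have e : g x = E.indicator (fun _ => (1 : ℝ)) x -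
            (E.indicator (fun _ => (1 : ℝ)) x - g x) := by ring
          nth_rw 1 [e]
          refine enorm_sub_le.trans (add_le_add_left (le_of_eq ?_) _)
          by_cases hx : x ∈ E <;> simp [hx]
      _ = ν E + ∫⁻ x, ‖E.indicator (fun _ => (1 : ℝ)) x - g x‖ₑ ∂ν := by
          rw [lintegral_add_left (measurable_const.indicator hE), lintegral_indicator hE]
          simp
      _ ≤ _ := by
          gcongr
          exact (lintegral_mono' hνm le_rfl).trans hgε
  calc ‖μ E‖ₑ ≤ (ν E + ε / 2) + ε / 2 := by
        rw [e1]
        exact (enorm_add_le _ _).trans (add_le_add (b1.trans b3) b2)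
    _ = ν E + ε := by rw [add_assoc, ENNReal.add_halves]

/-! ### Integrability of the weak gradient -/

/-- At some `c` in `(0,t)` the derivative equals the slope `(f t - f 0)/t`; integrating `f''` from
`0` to `c` carries this back to `0`. -/
theorem enorm_deriv_le {f f' f'' : ℝ → ℝ} (h1 : ∀ s, HasDerivAt f (f' s) s)
    (h2 : ∀ s, HasDerivAt f' (f'' s) s) (hc : Continuous f'') {t : ℝ} (ht : 0 < t) :
    ‖f' 0‖ₑ ≤ ENNReal.ofReal t⁻¹ * (‖f t‖ₑ + ‖f 0‖ₑ) + ∫⁻ s in Set.Ioc 0 t, ‖f'' s‖ₑ := by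
  obtain ⟨c, hct, hcs⟩ := exists_hasDerivAt_eq_slope f f' ht
    (continuous_iff_continuousAt.2 fun s => (h1 s).continuousAt).continuousOn fun s _ => h1 s
  have h3 := intervalIntegral.integral_eq_sub_of_hasDerivAt (a := 0) (b := c)
    (fun s _ => h2 s) (hc.intervalIntegrable 0 c)
  have e : f' 0 = t⁻¹ * (f t - f 0) - ∫ s in (0 : ℝ)..c, f'' s := by
    rw [h3, hcs]
    ring
  rw [e]
  refine enorm_sub_le.trans (add_le_add ?_ ?_)
  · rw [enorm_mul, Real.enorm_eq_ofReal (inv_nonneg.2 ht.le)]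
    exact mul_le_mul' le_rfl enorm_sub_le
  · rw [intervalIntegral.integral_of_le hct.1.le]
    exact (enorm_integral_le_lintegral_enorm _).trans
      (lintegral_mono_set (Set.Ioc_subset_Ioc_right hct.2.le))

theorem hasDerivAt_conv_line {u ψ : RN N → ℝ} (hu : Integrable u) (hψ : IsTestFunction ψ)
    (i : Fin N) (x : RN N) (s : ℝ) :
    HasDerivAt (fun s : ℝ => conv u ψ (x + s • EuclideanSpace.single i (1 : ℝ)))
      (conv u (partialDeriv i ψ) (x + s • EuclideanSpace.single i (1 : ℝ))) s := by
  set e : RN N := EuclideanSpace.single i (1 : ℝ)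
  have h1 : HasDerivAt (fun s : ℝ => x + s • e) e s := by
    simpa using ((hasDerivAt_id s).smul_const e).const_add x
  have h2 := ((contDiff_conv hu hψ).differentiable (by simp) (x + s • e)).hasFDerivAt
  have h3 := h2.comp_hasDerivAt s h1
  rwa [← partialDeriv_conv hu hψ]

/-- Interpolation of the first derivative between the function and its second derivative. -/
theorem lintegral_conv_partialDeriv_le {u ψ : RN N → ℝ} (hu : Integrable u)
    (hψ : IsTestFunction ψ) (i : Fin N) {t : ℝ} (ht : 0 < t) :
    ∫⁻ x, ‖conv u (partialDeriv i ψ) x‖ₑ ≤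
      ENNReal.ofReal (2 * t⁻¹) * (∫⁻ x, ‖conv u ψ x‖ₑ) +
        ENNReal.ofReal t * ∫⁻ x, ‖conv u (partialDeriv i (partialDeriv i ψ)) x‖ₑ := by
  have h1 := hψ.partialDeriv i
  have h2 := h1.partialDeriv i
  have c0 := (contDiff_conv hu hψ).continuous
  have c2 := (contDiff_conv hu h2).continuous
  set v := conv u ψ
  set w := conv u (partialDeriv i (partialDeriv i ψ))
  set e : RN N := EuclideanSpace.single i (1 : ℝ)
  have hline : Continuous fun p : RN N × ℝ => p.1 + p.2 • e := by fun_prop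
  calc ∫⁻ x, ‖conv u (partialDeriv i ψ) x‖ₑ
      ≤ ∫⁻ x, (ENNReal.ofReal t⁻¹ * (‖v (x + t • e)‖ₑ + ‖v x‖ₑ) +
          ∫⁻ s in Set.Ioc 0 t, ‖w (x + s • e)‖ₑ) := by
        refine lintegral_mono fun x => ?_
        simpa using enorm_deriv_le (hasDerivAt_conv_line hu hψ i x)
          (hasDerivAt_conv_line hu h1 i x) (c2.comp (by fun_prop)) ht
    _ = ENNReal.ofReal t⁻¹ * ((∫⁻ x, ‖v (x + t • e)‖ₑ) + ∫⁻ x, ‖v x‖ₑ) +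
          ∫⁻ s in Set.Ioc 0 t, ∫⁻ x, ‖w (x + s • e)‖ₑ := by
        rw [lintegral_add_left, lintegral_const_mul, lintegral_add_left,
          lintegral_lintegral_swap]
        · exact (c2.comp hline).enorm.measurable.aemeasurable
        · exact (c0.comp (by fun_prop)).enorm.measurable
        · exact ((c0.comp (by fun_prop)).enorm.add c0.enorm).measurable
        · exact (((c0.comp (by fun_prop)).enorm.add c0.enorm).measurable).const_mul _
    _ = _ := by
        simp only [lintegral_add_right_eq_self (μ := (volume : Measure (RN N))) (fun x => ‖v x‖ₑ),
          lintegral_add_right_eq_self (μ := (volume : Measure (RN N))) (fun x => ‖w x‖ₑ)]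
        rw [lintegral_const, Measure.restrict_apply MeasurableSet.univ, Set.univ_inter,
          Real.volume_Ioc, sub_zero, ENNReal.ofReal_mul zero_le_two, ← two_mul, ← mul_assoc,
          mul_comm (ENNReal.ofReal t⁻¹), mul_comm (lintegral _ _) (ENNReal.ofReal t)]
        simp

theorem IsTestFunction.sub {φ ψ : RN N → ℝ} (hφ : IsTestFunction φ) (hψ : IsTestFunction ψ) :
    IsTestFunction fun x => φ x - ψ x :=
  ⟨hφ.contDiff.sub hψ.contDiff, hφ.hasCompactSupport.sub hψ.hasCompactSupport⟩

theorem partialDeriv_sub {φ ψ : RN N → ℝ} (hφ : IsTestFunction φ) (hψ : IsTestFunction ψ)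
    (i : Fin N) : partialDeriv i (fun x => φ x - ψ x) =
      fun x => partialDeriv i φ x - partialDeriv i ψ x := by
  ext x
  rw [partialDeriv, ((hφ.hasFDerivAt x).fun_sub (hψ.hasFDerivAt x)).fderiv]
  rfl

theorem tendsto_integral_mul_of_tendsto_lintegral {ι : Type*} {l : Filter ι}
    {w : ι → RN N → ℝ} {v g : RN N → ℝ} (hw : ∀ k, Integrable (w k)) (hv : Integrable v)
    (h : Tendsto (fun k => ∫⁻ x, ‖w k x - v x‖ₑ) l (𝓝 0)) (hg : Continuous g) {C : ℝ}
    (hC : ∀ x, |g x| ≤ C) :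
    Tendsto (fun k => ∫ x, w k x * g x) l (𝓝 (∫ x, v x * g x)) := by
  have hi : ∀ {v : RN N → ℝ}, Integrable v → Integrable fun x => v x * g x := fun hv =>
    hv.mul_bdd (c := C) hg.aestronglyMeasurable (Eventually.of_forall hC)
  refine tendsto_integral_of_L1 _ (hi hv).aestronglyMeasurable
    (Eventually.of_forall fun k => hi (hw k)) ?_
  have h0 := ENNReal.Tendsto.mul_const (b := ENNReal.ofReal C) h (Or.inr ENNReal.ofReal_ne_top)
  rw [zero_mul] at h0
  refine tendsto_of_tendsto_of_tendsto_of_le_of_le tendsto_const_nhds h0 (fun _ => zero_le)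
    fun k => ?_
  rw [← lintegral_mul_const' _ _ ENNReal.ofReal_ne_top]
  refine lintegral_mono fun x => ?_
  simp only
  rw [← sub_mul, enorm_mul]
  refine mul_le_mul' le_rfl ?_
  rw [← ofReal_norm]
  exact ENNReal.ofReal_le_ofReal (hC x)

/-- An `L¹`-Cauchy sequence of integrable functions has a limit. -/
theorem exists_tendsto_lintegral_sub {w : ℕ → RN N → ℝ} (hw : ∀ k, Integrable (w k))
    (h : ∀ ε : ENNReal, 0 < ε → ∃ K, ∀ k ≥ K, ∀ l ≥ K, ∫⁻ x, ‖w k x - w l x‖ₑ < ε) :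
    ∃ v : RN N → ℝ, Integrable v ∧ Tendsto (fun k => ∫⁻ x, ‖w k x - v x‖ₑ) atTop (𝓝 0) := by
  have hd : ∀ {f g : RN N → ℝ} (hf : Integrable f) (hg : Integrable g),
      edist (hf.toL1 f) (hg.toL1 g) = ∫⁻ x, ‖f x - g x‖ₑ := fun hf hg => by
    rw [Integrable.edist_toL1_toL1]
    simp only [edist_eq_enorm_sub]
  have hcs : CauchySeq fun k => (hw k).toL1 (w k) := by
    refine EMetric.cauchySeq_iff.2 fun ε hε => ?_
    obtain ⟨K, hK⟩ := h ε hε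
    exact ⟨K, fun k hk l hl => by rw [hd]; exact hK k hk l hl⟩
  obtain ⟨v, hv⟩ := cauchySeq_tendsto_of_complete hcs
  have hvi := L1.integrable_coeFn v
  refine ⟨v, hvi, ?_⟩
  have := tendsto_iff_edist_tendsto_0.1 hv
  refine this.congr fun k => ?_
  rw [← hd (hw k) hvi, Integrable.toL1_coeFn]

/-- An integrable function whose distributional Hessian is a finite measure has an integrable
weak gradient. -/
theorem IsDistHessian.isHessianMeasure {u : RN N → ℝ} {μ : VectorMeasure (RN N) (Mat N)}
    (h : IsDistHessian u μ) (hu : Integrable u) (hμ : μ.variation Set.univ < ⊤) :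
    IsHessianMeasure u μ := by
  obtain ⟨η, hη⟩ := exists_isApproxIdentity N
  have ht := hη.isTestFunction
  have hdi : ∀ i k, Integrable (conv u (partialDeriv i (η k))) := fun i k =>
    integrable_conv hu ((ht k).partialDeriv i).integrable
  have hci : ∀ k, Integrable (conv u (η k)) := fun k => integrable_conv hu (ht k).integrable
  -- Interpolation for `u * (η k - η l)`: the zeroth-order term becomes small for large `k`, `l`,
  -- while the second-order term is merely bounded, by twice the variation.
  have hdiff : ∀ i k l, ∀ t : ℝ, 0 < t →
      ∫⁻ x, ‖conv u (partialDeriv i (η k)) x - conv u (partialDeriv i (η l)) x‖ₑ ≤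
        ENNReal.ofReal (2 * t⁻¹) * ((∫⁻ x, ‖conv u (η k) x - u x‖ₑ) +
          ∫⁻ x, ‖conv u (η l) x - u x‖ₑ) +
        ENNReal.ofReal t * (2 * μ.variation Set.univ) := fun i k l t h0 => by
    have hs := (ht k).sub (ht l)
    have e1 : ∀ x, conv u (partialDeriv i (η k)) x - conv u (partialDeriv i (η l)) x =
        conv u (partialDeriv i fun x => η k x - η l x) x := fun x => by
      rw [partialDeriv_sub (ht k) (ht l)]
      exact conv_sub_right x (((ht k).partialDeriv i).integrable_mul_comp_sub hu x)
        (((ht l).partialDeriv i).integrable_mul_comp_sub hu x)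
    simp only [e1]
    refine (lintegral_conv_partialDeriv_le hu hs i h0).trans
      (add_le_add (mul_le_mul' le_rfl ?_) (mul_le_mul' le_rfl ?_))
    · rw [← lintegral_add_left']
      · refine lintegral_mono fun x => ?_
        rw [← conv_sub_right x ((ht k).integrable_mul_comp_sub hu x)
          ((ht l).integrable_mul_comp_sub hu x)]
        rw [show conv u (η k) x - conv u (η l) x =
          (conv u (η k) x - u x) - (conv u (η l) x - u x) by ring]
        exact enorm_sub_le
      · exact ((hci k).sub hu).aestronglyMeasurable.enorm
    · have h1 : ∫⁻ x, ‖η k x - η l x‖ₑ ≤ 2 := by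
        calc _ ≤ ∫⁻ x, (‖η k x‖ₑ + ‖η l x‖ₑ) := lintegral_mono fun x => enorm_sub_le
          _ = 2 := by
            rw [lintegral_add_left' (ht k).integrable.aestronglyMeasurable.enorm,
              hη.lintegral_enorm, hη.lintegral_enorm, one_add_one_eq_two]
      refine le_trans (lintegral_mono fun x => ?_) ((h.lintegral_hessConv_le hμ hs).trans
        (mul_le_mul' h1 le_rfl))
      rw [← ofReal_norm, ← ofReal_norm]
      exact ENNReal.ofReal_le_ofReal
        (PiLp.norm_apply_le (hessConv u (fun x => η k x - η l x) x) (i, i))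
  have hg : ∀ i, ∃ g : RN N → ℝ, Integrable g ∧
      Tendsto (fun k => ∫⁻ x, ‖conv u (partialDeriv i (η k)) x - g x‖ₑ) atTop (𝓝 0) := fun i => by
    refine exists_tendsto_lintegral_sub (hdi i) fun ε hε => ?_
    -- First `t` is fixed so that the bounded term is below `ε/2`; only then are `k` and `l` taken
    -- large, since the other coefficient is `2/t`.
    have l1 : Tendsto (fun t : ℝ => ENNReal.ofReal t * (2 * μ.variation Set.univ)) (𝓝[>] 0)
        (𝓝 0) := by
      have : Tendsto (fun t : ℝ => ENNReal.ofReal t) (𝓝[>] 0) (𝓝 0) := by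
        simpa using (ENNReal.continuous_ofReal.tendsto 0).mono_left nhdsWithin_le_nhds
      simpa using ENNReal.Tendsto.mul_const (b := 2 * μ.variation Set.univ) this
        (Or.inr (ENNReal.mul_ne_top (by simp) hμ.ne))
    obtain ⟨t, htε, h0⟩ := ((l1.eventually (gt_mem_nhds (ENNReal.half_pos hε.ne'))).and
      self_mem_nhdsWithin).exists
    have l2 : Tendsto (fun p : ℕ × ℕ => ENNReal.ofReal (2 * t⁻¹) *
        ((∫⁻ x, ‖conv u (η p.1) x - u x‖ₑ) + ∫⁻ x, ‖conv u (η p.2) x - u x‖ₑ))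
        (atTop ×ˢ atTop) (𝓝 0) := by
      have := ENNReal.Tendsto.const_mul (a := ENNReal.ofReal (2 * t⁻¹))
        (((hη.tendsto u hu).comp tendsto_fst).add ((hη.tendsto u hu).comp
          (tendsto_snd (f := atTop)))) (Or.inr ENNReal.ofReal_ne_top)
      simpa using this
    rw [prod_atTop_atTop_eq] at l2
    obtain ⟨⟨K, L⟩, hKL⟩ := eventually_atTop.1
      (l2.eventually (gt_mem_nhds (ENNReal.half_pos hε.ne')))
    refine ⟨max K L, fun k hk l hl => (hdiff i k l t h0).trans_lt ?_⟩
    rw [← ENNReal.add_halves ε]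
    exact ENNReal.add_lt_add
      (hKL (k, l) ⟨(le_max_left _ _).trans hk, (le_max_right _ _).trans hl⟩) htε
  choose g hgi hgt using hg
  have hweak : IsWeakGradient u fun x => WithLp.toLp 2 fun i => g i x := fun φ hφ i => by
    have hφi := hφ.partialDeriv i
    obtain ⟨C, hC⟩ := hφ.exists_abs_le
    obtain ⟨D, hD⟩ := hφi.exists_abs_le
    have l1 := tendsto_integral_mul_of_tendsto_lintegral hci hu (hη.tendsto u hu)
      hφi.continuous hD
    have l2 := tendsto_integral_mul_of_tendsto_lintegral (hdi i) (hgi i) (hgt i)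
      hφ.continuous hC
    refine tendsto_nhds_unique l1 (l2.neg.congr fun k => ?_)
    have b1 : ∀ {w : RN N → ℝ}, Integrable w → Integrable fun x => w x * φ x := fun hw =>
      hw.mul_bdd (c := C) hφ.continuous.aestronglyMeasurable (Eventually.of_forall hC)
    have e := fun x => partialDeriv_conv hu (ht k) i x
    have := integral_mul_fderiv_eq_neg_fderiv_mul_of_integrable (μ := (volume : Measure (RN N)))
      (f := conv u (η k)) (g := φ) (v := EuclideanSpace.single i (1 : ℝ))
      ((b1 (hdi i k)).congr (Eventually.of_forall fun x => by
        simp only [← e]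
        rfl))
      ((hci k).mul_bdd (c := D) hφi.continuous.aestronglyMeasurable (Eventually.of_forall hD))
      (b1 (hci k)) (fun x _ => (contDiff_conv hu (ht k)).differentiable (by simp) x)
      (fun x _ => hφ.contDiff.differentiable (by simp) x)
    simp only [← e]
    exact this.symm
  refine ⟨hu, _, Integrable.of_eval_piLp fun i => hgi i, hweak, hμ, fun φ hφ i j => ?_⟩
  have h1 := hweak _ (hφ.partialDeriv j) i
  have h2 := h φ hφ i j
  rw [← h2, h1, neg_neg]

/-! ### The lower bound -/

/-- The functions converge in `L¹` against a fixed bounded second derivative, and the consistency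
error costs at most `C * truncMoment (ρ n) * ‖y n‖`, with bounded norms. -/
theorem tendsto_distNonlocalHess (hN : 1 ≤ N) {ρ : ℕ → RN N → ℝ} (hρ : IsRadialMollifierSeq ρ)
    {y : ℕ → Lp ℝ 1 (volume : Measure (RN N))} {u : Lp ℝ 1 (volume : Measure (RN N))}
    (hy : Tendsto y atTop (𝓝 u)) {φ : RN N → ℝ} (hφ : IsTestFunction φ) (i j : Fin N) :
    Tendsto (fun n => distNonlocalHess (ρ n) i j (y n) φ) atTop
      (𝓝 (∫ x, u x * partialDeriv i (partialDeriv j φ) x)) := by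
  have hφ2 := (hφ.partialDeriv j).partialDeriv i
  obtain ⟨D, hD⟩ := hφ2.exists_abs_le
  obtain ⟨C, hC0, hC⟩ := exists_nonlocalHess_sub_le hN hφ
  have hyi : ∀ n, Integrable (y n) := fun n => L1.integrable_coeFn _
  have hdist : Tendsto (fun n => ∫⁻ x, ‖y n x - u x‖ₑ) atTop (𝓝 0) := by
    refine (tendsto_iff_edist_tendsto_0.1 hy).congr fun n => ?_
    rw [← Integrable.toL1_coeFn (y n) (hyi n), ← Integrable.toL1_coeFn u (L1.integrable_coeFn u),
      Integrable.edist_toL1_toL1, Integrable.toL1_coeFn, Integrable.toL1_coeFn]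
    simp only [edist_eq_enorm_sub]
  have l1 := tendsto_integral_mul_of_tendsto_lintegral hyi (L1.integrable_coeFn u) hdist
    hφ2.continuous hD
  have l2 : Tendsto (fun n => C * truncMoment (ρ n) * ‖y n‖) atTop (𝓝 0) := by
    simpa using (hρ.tendsto_truncMoment.const_mul C).mul hy.norm
  have l3 : Tendsto (fun n => distNonlocalHess (ρ n) i j (y n) φ -
      ∫ x, y n x * partialDeriv i (partialDeriv j φ) x) atTop (𝓝 0) := by
    refine squeeze_zero_norm (fun n => ?_) l2
    have hn := hρ.isRadialMollifier n
    obtain ⟨E, hE⟩ := exists_nonlocalHess_le hN hn hφ i j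
    rw [distNonlocalHess, ← integral_sub
      ((hyi n).mul_bdd (c := E) (continuous_nonlocalHess hn hφ i j).aestronglyMeasurable
        (Eventually.of_forall hE))
      ((hyi n).mul_bdd (c := D) hφ2.continuous.aestronglyMeasurable (Eventually.of_forall hD)),
      L1.norm_eq_integral_norm, ← integral_const_mul]
    refine norm_integral_le_of_norm_le ((hyi n).norm.const_mul _) (Eventually.of_forall fun x => ?_)
    rw [← mul_sub, norm_mul, mul_comm]
    exact mul_le_mul_of_nonneg_right (hC _ hn i j x) (norm_nonneg _)
  simpa using l3.add l1

theorem hessianVariation_le_liminf (hN : 1 ≤ N) {ρ : ℕ → RN N → ℝ}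
    (hρ : IsRadialMollifierSeq ρ) {y : ℕ → Lp ℝ 1 (volume : Measure (RN N))}
    {u : Lp ℝ 1 (volume : Measure (RN N))} (hy : Tendsto y atTop (𝓝 u)) :
    hessianVariation u ≤ liminf (fun n => nonlocalEnergy (ρ n) (y n)) atTop := by
  -- It is enough to bound by each finite `L` above the liminf; infinitely many energies lie below
  -- such an `L`, which gives a subsequence bounded in `L¹`.
  refine le_of_forall_gt_imp_ge_of_dense fun L hL => ?_
  rcases eq_or_ne L ⊤ with rfl | hLtop
  · exact le_top
  obtain ⟨s, hs, hsL⟩ := extraction_of_frequently_atTop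
    (frequently_lt_of_liminf_lt (by isBoundedDefault) hL)
  have hex : ∀ n, ∃ G : RN N → Mat N, IsNonlocalHessianFunction (ρ (s n)) (y (s n)) G ∧
      ∫⁻ x, ‖G x‖ₑ < L := fun n => by
    obtain ⟨G, h⟩ := iInf_lt_iff.1 (hsL n)
    obtain ⟨hG, hGL⟩ := iInf_lt_iff.1 h
    exact ⟨G, hG, hGL⟩
  choose G hG hGL using hex
  have hGi : ∀ n, Integrable (G n) := fun n =>
    ⟨(hG n).locallyIntegrable.aestronglyMeasurable, (hGL n).trans_le le_top⟩
  obtain ⟨μ, hμ, hμt⟩ := exists_weak_limit_mat (hyperfilter ℕ) hGi (B := L.toReal) fun n => by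
    rw [integral_norm_eq_lintegral_enorm (hGi n).aestronglyMeasurable]
    exact ENNReal.toReal_mono hLtop (hGL n).le
  rw [ENNReal.ofReal_toReal hLtop] at hμ
  have hd : IsDistHessian u μ := fun φ hφ i j => by
    -- The hyperfilter refines `atTop`, so this limit and the ultrafilter limit of the densities
    -- must agree.
    have l1 := ((tendsto_distNonlocalHess hN hρ hy hφ i j).comp hs.tendsto_atTop).mono_left
      Nat.hyperfilter_le_atTop
    refine tendsto_nhds_unique l1
      ((hμt φ hφ.continuous hφ.hasCompactSupport (i, j)).congr fun n => ?_)
    rw [Function.comp_apply, (hG n).pairing φ hφ]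
    simp only [mul_comm]
  exact (iInf₂_le μ (hd.isHessianMeasure (L1.integrable_coeFn u)
    (hμ.trans_lt hLtop.lt_top))).trans hμ

end NonlocalHessian

end

theorem theorem1p8 (N : ℕ) (hN : 1 ≤ N) (ρ : ℕ → NonlocalHessian.RN N → ℝ)
    (hρ : NonlocalHessian.IsRadialMollifierSeq ρ)
    (u : Lp ℝ 1 (volume : Measure (NonlocalHessian.RN N))) :
    NonlocalHessian.GammaConvergesAt
      (fun n (v : Lp ℝ 1 (volume : Measure (NonlocalHessian.RN N))) =>
        NonlocalHessian.nonlocalEnergy (ρ n) v)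
      (fun v => NonlocalHessian.hessianVariation v) u :=
  ⟨fun _ hy => NonlocalHessian.hessianVariation_le_liminf hN hρ hy,
    NonlocalHessian.exists_recovery_sequence hN hρ u⟩
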